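/- Let $m,n\ge 2$ be integers, let $M_k$ denote the space of $k\times k$ complex matrices, and for $X\in M_k$ let $$w(X)=\sup\{|u^*Xu| : u\in\mathbb C^k,\ u^*u=1\}$$ be its numerical radius. Write $A\otimes B\in M_{mn}$ for the Kronecker product of $A\in M_m$ and $B\in M_n$, $X^t$ for the transpose and $X^*$ for the conjugate transpose of $X$. The following are equivalent for a complex-linear map $\phi:M_{mn}\to M_{mn}$. (a) $w(\phi(A\otimes B))=w(A\otimes B)$ for all $A\in M_m$ and $B\in M_n$. (b) There are a unitary matrix $U\in M_{mn}$, a complex number $\xi$ with $|\xi|=1$, and maps $\varphi_1:M_m\to M_m$ and $\varphi_2:M_n\to M_n$, each of which is the identity map $X\mapsto X$ or the transposition map $X\mapsto X^t$, such that $$\phi(A\otimes B)=\xi\,U(\varphi_1(A)\otimes\varphi_2(B))U^*\quad\text{for all } A\in M_m,\ B\in M_n,$$ and such that, if $m\ge 3$ and $n\ge 3$, then $\varphi_1$ and $\varphi_2$ are both the identity map or both the transposition map. -/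

import Mathlib

open scoped Kronecker Matrix

/-- The numerical range `W(A) = {u* A u : u ∈ ℂᵏ, u* u = 1}` of a complex square matrix. -/
def numericalRange {k : Type*} [Fintype k] (A : Matrix k k ℂ) : Set ℂ :=
  {z | ∃ u : k → ℂ, star u ⬝ᵥ u = 1 ∧ z = star u ⬝ᵥ (A *ᵥ u)}

/-- The numerical radius `w(A) = sup {|z| : z ∈ W(A)}` of a complex square matrix.
The set is always bounded, and it is nonempty as soon as the index type is. -/
noncomputable def numericalRadius {k : Type*} [Fintype k] (A : Matrix k k ℂ) : ℝ :=
  sSup ((fun z : ℂ => ‖z‖) '' numericalRange A)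

/-! ### Basic properties of the numerical radius: compactness, homogeneity and invariances. -/

section NumericalRadius

variable {k : Type*} [Fintype k]

/-! For (a) ⇒ (b), the starting point is an extremality principle. If `w(A + θB) ≤ 1` for every
unimodular `θ` and a unit vector `u` satisfies `|u*Au| = 1`, then `Bu = B*u = 0`
(`mulVec_eq_zero_of_extremal`). Take orthonormal bases of the two factors and the images under `φ`
of the `mn` products of their rank-one projections. The principle makes their extremal vectors an
orthonormal basis, so these images are, up to phases, mutually orthogonal rank-one projections
(`exists_unitary_conj_single`).

The phases all agree. The form `(A, B) ↦ tr φ(A ⊗ B)` has modulus one on products of rank-one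
projections, and a linear functional of modulus one on rank-one projections is a multiple of the
trace (`exists_eq_mul_trace`). Dividing by the common phase `ξ` gives a map `χ` with `χ(XDX* ⊗
YD'Y*) = W(D ⊗ D')W*` for diagonal `D`, `D'`, where the unitary `W` depends only on the unitaries
`X`, `Y`.

By the spectral theorem, `A ↦ χ(A ⊗ 1)` and `B ↦ χ(1 ⊗ B)` are then commuting self-adjoint Jordan
homomorphisms whose product is `χ(A ⊗ B)`. Products of their diagonal idempotents have rank one;
this forces each of them to be multiplicative or anti-multiplicative
(`IsJordanHom.map_mul_or_map_mul_rev_of_commute`). After transposing where needed, they are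
commuting representations on a space of dimension `mn`, hence jointly unitarily similar to `A ⊗ B`
(`exists_unitary_mul_eq_conj_kronecker`). If both sizes are at least 3, a pair of weighted shifts
excludes transposing exactly one factor.

For (b) ⇒ (a), full transposition preserves `w`, and a two-by-two matrix is unitarily similar to its
transpose, so partial transposition is harmless when one size is 2. -/

theorem star_dotProduct_self_eq (u : k → ℂ) :
    star u ⬝ᵥ u = ((∑ i, ‖u i‖ ^ 2 : ℝ) : ℂ) := by
  simp [dotProduct, ← Complex.normSq_eq_norm_sq, Complex.normSq_eq_conj_mul_self]

theorem isCompact_unitVectors : IsCompact {u : k → ℂ | star u ⬝ᵥ u = 1} := by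
  refine Metric.isCompact_of_isClosed_isBounded ?_ ?_
  · exact isClosed_eq (by unfold dotProduct; simp only [Pi.star_apply]; fun_prop) continuous_const
  · refine (Metric.isBounded_closedBall (x := (0 : k → ℂ)) (r := 1)).subset fun u hu => ?_
    rw [mem_closedBall_zero_iff, pi_norm_le_iff_of_nonneg zero_le_one]
    intro i
    have h : ∑ i, ‖u i‖ ^ 2 = 1 := by
      have := (star_dotProduct_self_eq u).symm.trans hu
      exact_mod_cast this
    have h2 : ‖u i‖ ^ 2 ≤ 1 := h ▸ Finset.single_le_sum (f := fun i => ‖u i‖ ^ 2)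
      (fun _ _ => by positivity) (Finset.mem_univ i)
    nlinarith [norm_nonneg (u i)]

theorem numericalRadius_image_eq (A : Matrix k k ℂ) :
    (fun z : ℂ => ‖z‖) '' numericalRange A =
      (fun u : k → ℂ => ‖star u ⬝ᵥ (A *ᵥ u)‖) '' {u : k → ℂ | star u ⬝ᵥ u = 1} := by
  ext r
  constructor
  · rintro ⟨z, ⟨u, hu, rfl⟩, rfl⟩
    exact ⟨u, hu, rfl⟩
  · rintro ⟨u, hu, rfl⟩
    exact ⟨_, ⟨u, hu, rfl⟩, rfl⟩

theorem isCompact_norm_numericalRange (A : Matrix k k ℂ) :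
    IsCompact ((fun z : ℂ => ‖z‖) '' numericalRange A) := by
  rw [numericalRadius_image_eq]
  refine isCompact_unitVectors.image ?_
  unfold dotProduct Matrix.mulVec dotProduct
  simp only [Pi.star_apply]
  fun_prop

theorem norm_le_numericalRadius (A : Matrix k k ℂ) {u : k → ℂ} (hu : star u ⬝ᵥ u = 1) :
    ‖star u ⬝ᵥ (A *ᵥ u)‖ ≤ numericalRadius A :=
  le_csSup (isCompact_norm_numericalRange A).bddAbove ⟨_, ⟨u, hu, rfl⟩, rfl⟩

theorem exists_norm_eq_numericalRadius [Nonempty k] (A : Matrix k k ℂ) :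
    ∃ u : k → ℂ, star u ⬝ᵥ u = 1 ∧ ‖star u ⬝ᵥ (A *ᵥ u)‖ = numericalRadius A := by
  classical
  obtain ⟨i⟩ := ‹Nonempty k›
  have hne : ((fun z : ℂ => ‖z‖) '' numericalRange A).Nonempty :=
    ⟨_, _, ⟨Pi.single i 1, by simp, rfl⟩, rfl⟩
  obtain ⟨z, ⟨u, hu, rfl⟩, h⟩ := (isCompact_norm_numericalRange A).sSup_mem hne
  exact ⟨u, hu, h⟩

theorem numericalRadius_le [Nonempty k] {A : Matrix k k ℂ} {c : ℝ}
    (h : ∀ u : k → ℂ, ‖star u ⬝ᵥ (A *ᵥ u)‖ ≤ c * ∑ i, ‖u i‖ ^ 2) : numericalRadius A ≤ c := by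
  obtain ⟨u, hu, he⟩ := exists_norm_eq_numericalRadius A
  have h1 : ∑ i, ‖u i‖ ^ 2 = 1 := by
    have := (star_dotProduct_self_eq u).symm.trans hu
    exact_mod_cast this
  have := h u
  rw [h1] at this
  linarith

theorem norm_le_numericalRadius_mul (A : Matrix k k ℂ) (u : k → ℂ) :
    ‖star u ⬝ᵥ (A *ᵥ u)‖ ≤ numericalRadius A * ∑ i, ‖u i‖ ^ 2 := by
  set s : ℝ := ∑ i, ‖u i‖ ^ 2 with hs
  have hs0 : 0 ≤ s := Finset.sum_nonneg fun _ _ => by positivity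
  rcases hs0.eq_or_lt with h0 | hpos
  · have hu : u = 0 := by
      ext i
      have := (Finset.sum_eq_zero_iff_of_nonneg (fun i _ => by positivity)).1 (hs.symm.trans h0.symm)
        i (Finset.mem_univ i)
      simpa using this
    simp [hu, ← h0]
  · have hr : (Real.sqrt s) ≠ 0 := (Real.sqrt_pos.2 hpos).ne'
    have hss : Real.sqrt s * Real.sqrt s = s := Real.mul_self_sqrt hs0
    have hc : (((Real.sqrt s)⁻¹ : ℝ) : ℂ) * (((Real.sqrt s)⁻¹ : ℝ) : ℂ) = ((s⁻¹ : ℝ) : ℂ) := by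
      rw [← Complex.ofReal_mul, ← mul_inv, hss]
    have hst : star ((((Real.sqrt s)⁻¹ : ℝ) : ℂ)) = (((Real.sqrt s)⁻¹ : ℝ) : ℂ) :=
      Complex.conj_ofReal _
    have key := norm_le_numericalRadius A (u := (((Real.sqrt s)⁻¹ : ℝ) : ℂ) • u) (by
      rw [star_smul, smul_dotProduct, dotProduct_smul, smul_smul, hst, hc, star_dotProduct_self_eq,
        smul_eq_mul, ← Complex.ofReal_mul, ← hs, inv_mul_cancel₀ hpos.ne', Complex.ofReal_one])
    rw [star_smul, smul_dotProduct, Matrix.mulVec_smul, dotProduct_smul, smul_smul, hst, hc,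
      smul_eq_mul, norm_mul, Complex.norm_real, Real.norm_of_nonneg (inv_nonneg.2 hs0),
      inv_mul_le_iff₀ hpos] at key
    linarith

theorem numericalRadius_smul {ξ : ℂ} (hξ : ‖ξ‖ = 1) (A : Matrix k k ℂ) :
    numericalRadius (ξ • A) = numericalRadius A := by
  unfold numericalRadius
  rw [numericalRadius_image_eq, numericalRadius_image_eq]
  simp [Matrix.smul_mulVec, hξ]

theorem numericalRange_transpose (A : Matrix k k ℂ) :
    numericalRange Aᵀ = numericalRange A := by
  have key : ∀ B : Matrix k k ℂ, numericalRange Bᵀ ⊆ numericalRange B := by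
    rintro B z ⟨u, hu, rfl⟩
    refine ⟨star u, by rw [star_star, dotProduct_comm, hu], ?_⟩
    rw [star_star, Matrix.mulVec_transpose, dotProduct_comm, ← Matrix.dotProduct_mulVec]
  refine (key A).antisymm ?_
  have := key Aᵀ
  rwa [Matrix.transpose_transpose] at this

theorem numericalRadius_transpose (A : Matrix k k ℂ) :
    numericalRadius Aᵀ = numericalRadius A := by
  unfold numericalRadius; rw [numericalRange_transpose]

variable [DecidableEq k]

theorem numericalRange_conj {U : Matrix k k ℂ} (hU : U ∈ Matrix.unitaryGroup k ℂ)
    (A : Matrix k k ℂ) : numericalRange (U * A * Uᴴ) = numericalRange A := by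
  have key : ∀ V ∈ Matrix.unitaryGroup k ℂ, ∀ B : Matrix k k ℂ,
      numericalRange (V * B * Vᴴ) ⊆ numericalRange B := by
    rintro V hV B z ⟨u, hu, rfl⟩
    have hVV : V * Vᴴ = 1 := (Matrix.mem_unitaryGroup_iff).1 hV
    have hs : star (Vᴴ *ᵥ u) = star u ᵥ* V := by
      rw [Matrix.star_mulVec, Matrix.conjTranspose_conjTranspose]
    refine ⟨Vᴴ *ᵥ u, ?_, ?_⟩
    · rw [hs, ← Matrix.dotProduct_mulVec, Matrix.mulVec_mulVec, hVV, Matrix.one_mulVec, hu]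
    · rw [hs, ← Matrix.dotProduct_mulVec, Matrix.mulVec_mulVec, Matrix.mulVec_mulVec, mul_assoc]
  refine (key U hU A).antisymm ?_
  have h1 := key Uᴴ (Unitary.star_mem hU) (U * A * Uᴴ)
  have hUU : Uᴴ * U = 1 := (Matrix.mem_unitaryGroup_iff').1 hU
  have h2 : Uᴴ * (U * A * Uᴴ) * Uᴴᴴ = A := by
    rw [Matrix.conjTranspose_conjTranspose]
    calc Uᴴ * (U * A * Uᴴ) * U = (Uᴴ * U) * A * (Uᴴ * U) := by simp only [mul_assoc]
      _ = A := by rw [hUU, one_mul, mul_one]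
  rwa [h2] at h1

theorem numericalRadius_conj {U : Matrix k k ℂ} (hU : U ∈ Matrix.unitaryGroup k ℂ)
    (A : Matrix k k ℂ) : numericalRadius (U * A * Uᴴ) = numericalRadius A := by
  unfold numericalRadius; rw [numericalRange_conj hU]

theorem numericalRadius_diagonal_le [Nonempty k] {d : k → ℂ} (hd : ∀ i, ‖d i‖ ≤ 1) :
    numericalRadius (Matrix.diagonal d) ≤ 1 := by
  refine numericalRadius_le fun u => ?_
  rw [one_mul, dotProduct]
  refine (norm_sum_le _ _).trans (Finset.sum_le_sum fun i _ => ?_)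
  rw [Matrix.mulVec_diagonal, norm_mul, norm_mul, Pi.star_apply, norm_star]
  nlinarith [hd i, mul_nonneg (norm_nonneg (u i)) (norm_nonneg (u i))]

theorem one_le_numericalRadius_single (i : k) :
    1 ≤ numericalRadius (Matrix.single i i (1 : ℂ)) := by
  have := norm_le_numericalRadius (Matrix.single i i (1 : ℂ)) (u := Pi.single i 1)
    (by simp)
  simpa [← Pi.single_star] using this

end NumericalRadius

/-! ### Vectors attaining the numerical radius. -/

section Extremal

open scoped ComplexOrder

variable {k : Type*} [Fintype k]

theorem conj_dotProduct_mulVec (A : Matrix k k ℂ) (u : k → ℂ) :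
    star u ⬝ᵥ (Aᴴ *ᵥ u) = star (star u ⬝ᵥ (A *ᵥ u)) := by
  rw [Matrix.star_dotProduct, Matrix.star_mulVec, Matrix.conjTranspose_conjTranspose,
    ← Matrix.dotProduct_mulVec]

/-- If the numerical radius is at most one and `u` attains it, then `u` is fixed by the real part
of the suitably rotated matrix. -/
theorem mulVec_add_conjTranspose_of_extremal {A : Matrix k k ℂ} (hA : numericalRadius A ≤ 1)
    {u : k → ℂ} (hu : star u ⬝ᵥ u = 1) (h1 : ‖star u ⬝ᵥ (A *ᵥ u)‖ = 1) :
    star (star u ⬝ᵥ (A *ᵥ u)) • (A *ᵥ u) + (star u ⬝ᵥ (A *ᵥ u)) • (Aᴴ *ᵥ u) = (2 : ℂ) • u := by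
  classical
  set ξ := star u ⬝ᵥ (A *ᵥ u) with hξ
  have hξξ : star ξ * ξ = 1 := by
    have := Complex.normSq_eq_conj_mul_self (z := ξ)
    rw [Complex.normSq_eq_norm_sq, h1] at this
    simpa using this.symm
  -- `H` is positive semidefinite because `w(A) ≤ 1`, and its quadratic form vanishes at `u`; hence
  -- `H u = 0`, which is the claim.
  set H : Matrix k k ℂ := (2 : ℂ) • (1 : Matrix k k ℂ) - (star ξ • A + ξ • Aᴴ) with hH
  have hq : ∀ x, star x ⬝ᵥ (H *ᵥ x) = ((2 * ∑ i, ‖x i‖ ^ 2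
      - 2 * (star ξ * (star x ⬝ᵥ (A *ᵥ x))).re : ℝ) : ℂ) := by
    intro x
    have e : star ξ * (star x ⬝ᵥ (A *ᵥ x)) + ξ * star (star x ⬝ᵥ (A *ᵥ x)) =
        ((2 * (star ξ * (star x ⬝ᵥ (A *ᵥ x))).re : ℝ) : ℂ) := by
      have := Complex.add_conj (star ξ * (star x ⬝ᵥ (A *ᵥ x)))
      rw [← this]
      simp
    rw [hH, Matrix.sub_mulVec, Matrix.add_mulVec, Matrix.smul_mulVec, Matrix.smul_mulVec,
      Matrix.smul_mulVec, Matrix.one_mulVec, dotProduct_sub, dotProduct_add, dotProduct_smul,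
      dotProduct_smul, dotProduct_smul, star_dotProduct_self_eq, conj_dotProduct_mulVec,
      smul_eq_mul, smul_eq_mul, smul_eq_mul, e]
    push_cast
    ring
  have hpsd : H.PosSemidef := by
    refine Matrix.PosSemidef.of_dotProduct_mulVec_nonneg ?_ fun x => ?_
    · rw [Matrix.IsHermitian, hH]
      simp [Matrix.conjTranspose_sub, Matrix.conjTranspose_smul, add_comm]
    · rw [hq]
      have h2 : (star ξ * (star x ⬝ᵥ (A *ᵥ x))).re ≤ ∑ i, ‖x i‖ ^ 2 := by
        refine (Complex.re_le_norm _).trans ?_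
        rw [norm_mul, norm_star, h1, one_mul]
        have h3 := norm_le_numericalRadius_mul A x
        have h4 : (0 : ℝ) ≤ ∑ i, ‖x i‖ ^ 2 := Finset.sum_nonneg fun _ _ => by positivity
        nlinarith
      exact_mod_cast (by linarith :
        (0 : ℝ) ≤ 2 * ∑ i, ‖x i‖ ^ 2 - 2 * (star ξ * (star x ⬝ᵥ (A *ᵥ x))).re)
  have h0 : H *ᵥ u = 0 := by
    refine (hpsd.dotProduct_mulVec_zero_iff u).1 ?_
    have hs : (∑ i, ‖u i‖ ^ 2 : ℝ) = 1 := by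
      have := (star_dotProduct_self_eq u).symm.trans hu
      exact_mod_cast this
    rw [hq, ← hξ, hξξ, hs]
    simp
  rw [hH, Matrix.sub_mulVec, Matrix.add_mulVec, Matrix.smul_mulVec, Matrix.smul_mulVec,
      Matrix.smul_mulVec, Matrix.one_mulVec, sub_eq_zero] at h0
  exact h0.symm

theorem eq_zero_of_norm_add_mul_le {a b : ℂ} (ha : ‖a‖ = 1)
    (h : ∀ θ : ℂ, ‖θ‖ = 1 → ‖a + θ * b‖ ≤ 1) : b = 0 := by
  have key : ∀ c : ℂ, ‖a + c‖ ≤ 1 → ‖a - c‖ ≤ 1 → c = 0 := by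
    intro c h1 h2
    have := parallelogram_law_with_norm ℝ a c
    rw [ha] at this
    have hc : ‖c‖ = 0 := by nlinarith [norm_nonneg c, norm_nonneg (a + c), norm_nonneg (a - c)]
    simpa using hc
  refine key b ?_ ?_
  · simpa using h 1 (by simp)
  · simpa [sub_eq_add_neg] using h (-1) (by simp)

/-- The bound first forces `u*Bu = 0`, so `u` is extremal for every `A + θB` with the same value
`ξ`. The fixed-vector equation then holds for all unimodular `θ`, and its coefficients at `θ` and at
the conjugate of `θ` must vanish. -/
theorem mulVec_eq_zero_of_extremal {A B : Matrix k k ℂ}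
    (h : ∀ θ : ℂ, ‖θ‖ = 1 → numericalRadius (A + θ • B) ≤ 1) {u : k → ℂ}
    (hu : star u ⬝ᵥ u = 1) (h1 : ‖star u ⬝ᵥ (A *ᵥ u)‖ = 1) : B *ᵥ u = 0 ∧ Bᴴ *ᵥ u = 0 := by
  have hq : ∀ θ : ℂ, star u ⬝ᵥ ((A + θ • B) *ᵥ u) =
      star u ⬝ᵥ (A *ᵥ u) + θ * (star u ⬝ᵥ (B *ᵥ u)) := by
    intro θ
    rw [Matrix.add_mulVec, Matrix.smul_mulVec, dotProduct_add, dotProduct_smul, smul_eq_mul]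
  have hb : star u ⬝ᵥ (B *ᵥ u) = 0 := by
    refine eq_zero_of_norm_add_mul_le h1 fun θ hθ => ?_
    rw [← hq]
    exact (norm_le_numericalRadius _ hu).trans (h θ hθ)
  have hq' : ∀ θ : ℂ, star u ⬝ᵥ ((A + θ • B) *ᵥ u) = star u ⬝ᵥ (A *ᵥ u) := by
    intro θ; rw [hq, hb, mul_zero, add_zero]
  set ξ := star u ⬝ᵥ (A *ᵥ u) with hξ
  have hξ0 : ξ ≠ 0 := by
    intro h0; rw [h0] at h1; simp at h1
  have key : ∀ θ : ℂ, ‖θ‖ = 1 → star ξ • (A *ᵥ u + θ • (B *ᵥ u)) +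
      ξ • (Aᴴ *ᵥ u + star θ • (Bᴴ *ᵥ u)) = (2 : ℂ) • u := by
    intro θ hθ
    have := mulVec_add_conjTranspose_of_extremal (h θ hθ) hu (by rw [hq', h1])
    rw [hq', Matrix.conjTranspose_add, Matrix.conjTranspose_smul, Matrix.add_mulVec,
      Matrix.smul_mulVec, Matrix.add_mulVec, Matrix.smul_mulVec] at this
    exact this
  -- The fourth roots of unity are enough to separate the coefficients of `1`, `θ` and the conjugate
  -- of `θ`.
  have k1 := key 1 (by simp)
  have k2 := key (-1) (by simp)
  have k3 := key Complex.I (by simp)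
  have k4 := key (-Complex.I) (by simp)
  have hsξ : star ξ ≠ 0 := by simpa using hξ0
  constructor
  · ext i
    have e1 := congrFun k1 i
    have e2 := congrFun k2 i
    have e3 := congrFun k3 i
    have e4 := congrFun k4 i
    simp only [Pi.add_apply, Pi.smul_apply, smul_eq_mul, star_neg, star_one, Complex.star_def,
      Complex.conj_I] at e1 e2 e3 e4 hsξ
    refine (mul_eq_zero.1 ?_).resolve_left hsξ
    linear_combination (1 / 4) * (e1 - e2) - Complex.I / 4 * (e3 - e4)
      + (1 / 2 * (starRingEnd ℂ ξ * (B *ᵥ u) i) - 1 / 2 * (ξ * (Bᴴ *ᵥ u) i)) * Complex.I_sq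
  · ext i
    have e1 := congrFun k1 i
    have e2 := congrFun k2 i
    have e3 := congrFun k3 i
    have e4 := congrFun k4 i
    simp only [Pi.add_apply, Pi.smul_apply, smul_eq_mul, star_neg, star_one, Complex.star_def,
      Complex.conj_I] at e1 e2 e3 e4
    refine (mul_eq_zero.1 ?_).resolve_left hξ0
    linear_combination (1 / 4) * (e1 - e2) + Complex.I / 4 * (e3 - e4)
      - (1 / 2 * (starRingEnd ℂ ξ * (B *ᵥ u) i) - 1 / 2 * (ξ * (Bᴴ *ᵥ u) i)) * Complex.I_sq

variable [DecidableEq k]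

/-- A family of matrices, as many as the dimension, that behaves with respect to the numerical
radius like the diagonal matrix units is, up to phases, unitarily similar to the diagonal
matrix units. -/
theorem exists_unitary_conj_single (T : k → Matrix k k ℂ)
    (h1 : ∀ p, numericalRadius (T p) = 1)
    (h2 : ∀ p q, p ≠ q → ∀ θ : ℂ, ‖θ‖ = 1 → numericalRadius (T p + θ • T q) ≤ 1) :
    ∃ W ∈ Matrix.unitaryGroup k ℂ, ∃ ξ : k → ℂ, (∀ p, ‖ξ p‖ = 1) ∧
      ∀ p, T p = ξ p • (W * Matrix.single p p 1 * Wᴴ) := by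
  have hex : ∀ p, ∃ u : k → ℂ, star u ⬝ᵥ u = 1 ∧ ‖star u ⬝ᵥ (T p *ᵥ u)‖ = 1 := by
    intro p
    have : Nonempty k := ⟨p⟩
    obtain ⟨u, hu, h⟩ := exists_norm_eq_numericalRadius (T p)
    exact ⟨u, hu, h.trans (h1 p)⟩
  choose u hu hξ using hex
  have hz : ∀ p q, p ≠ q → T q *ᵥ u p = 0 ∧ (T q)ᴴ *ᵥ u p = 0 := fun p q hpq =>
    mulVec_eq_zero_of_extremal (h2 p q hpq) (hu p) (hξ p)
  have hfix : ∀ p, star (star (u p) ⬝ᵥ (T p *ᵥ u p)) • (T p *ᵥ u p) +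
      (star (u p) ⬝ᵥ (T p *ᵥ u p)) • ((T p)ᴴ *ᵥ u p) = (2 : ℂ) • u p := fun p =>
    mulVec_add_conjTranspose_of_extremal (h1 p).le (hu p) (hξ p)
  have hleft : ∀ p q, p ≠ q → ∀ v, star (u p) ⬝ᵥ (T q *ᵥ v) = 0 := by
    intro p q hpq v
    have : star (u p) ᵥ* T q = star ((T q)ᴴ *ᵥ u p) := by
      rw [Matrix.star_mulVec, Matrix.conjTranspose_conjTranspose]
    rw [Matrix.dotProduct_mulVec, this, (hz p q hpq).2, star_zero, zero_dotProduct]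
  have hleft' : ∀ p q, p ≠ q → ∀ v, star (u p) ⬝ᵥ ((T q)ᴴ *ᵥ v) = 0 := by
    intro p q hpq v
    rw [Matrix.dotProduct_mulVec, ← Matrix.star_mulVec, (hz p q hpq).1, star_zero, zero_dotProduct]
  -- Pairing the fixed-vector equation of `u q` with `u p` kills its left side.
  have hort : ∀ p q, p ≠ q → star (u p) ⬝ᵥ u q = 0 := by
    intro p q hpq
    have := congrArg (fun v => star (u p) ⬝ᵥ v) (hfix q)
    simp only [dotProduct_add, dotProduct_smul, hleft p q hpq, hleft' p q hpq, smul_zero,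
      add_zero] at this
    simpa using this.symm
  set W : Matrix k k ℂ := Matrix.of fun i p => u p i with hW
  have hcol : ∀ (M : Matrix k k ℂ) a b, (Wᴴ * M * W) a b = star (u a) ⬝ᵥ (M *ᵥ u b) := by
    intro M a b
    rw [mul_assoc]
    simp only [Matrix.mul_apply, dotProduct, Matrix.mulVec, hW, Matrix.conjTranspose_apply,
      Matrix.of_apply, Pi.star_apply]
  have hWW : Wᴴ * W = 1 := by
    ext a b
    have := hcol 1 a b
    rw [mul_one, Matrix.one_mulVec] at this
    rw [this]
    by_cases hab : a = b
    · subst hab; simp [hu]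
    · rw [hort a b hab, Matrix.one_apply_ne hab]
  have hWU : W ∈ Matrix.unitaryGroup k ℂ := Matrix.mem_unitaryGroup_iff'.2 hWW
  have hWW' : W * Wᴴ = 1 := Matrix.mem_unitaryGroup_iff.1 hWU
  refine ⟨W, hWU, fun p => star (u p) ⬝ᵥ (T p *ᵥ u p), hξ, fun p => ?_⟩
  have e : Wᴴ * T p * W = (star (u p) ⬝ᵥ (T p *ᵥ u p)) • Matrix.single p p 1 := by
    ext a b
    rw [hcol, Matrix.smul_apply]
    by_cases hb : p = b
    · by_cases ha : p = a
      · subst hb; subst ha; simp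
      · rw [hleft a p (Ne.symm ha), Matrix.single_apply_of_row_ne ha, smul_zero]
    · rw [(hz b p (Ne.symm hb)).1, Matrix.single_apply_of_col_ne _ _ hb]
      simp
  calc T p = (W * Wᴴ) * T p * (W * Wᴴ) := by rw [hWW', one_mul, mul_one]
    _ = W * (Wᴴ * T p * W) * Wᴴ := by simp only [mul_assoc]
    _ = _ := by rw [e, Matrix.mul_smul, Matrix.smul_mul]

end Extremal

/-! ### Linear functionals of modulus one on rank-one projections. -/

section UnitFunctional

/-- On each coordinate axis, the coefficients of `s` and `s²` give `p = 0` and `q² + 2e = 2`; so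
everything reduces to `e = 1`. -/
theorem eq_one_and_eq_zero_of_quadratic {p₁ q₁ p₂ q₂ e f : ℝ} (hef : e ^ 2 + f ^ 2 = 1)
    (h : ∀ x y : ℝ, (1 + x * p₁ + y * p₂ + (x ^ 2 + y ^ 2) * e) ^ 2 +
      (x * q₁ + y * q₂ + (x ^ 2 + y ^ 2) * f) ^ 2 = (1 + (x ^ 2 + y ^ 2)) ^ 2) :
    (e = 1 ∧ f = 0) ∧ (p₁ = 0 ∧ q₁ = 0) ∧ p₂ = 0 ∧ q₂ = 0 := by
  have line : ∀ p q : ℝ, (∀ s : ℝ, (1 + s * p + s ^ 2 * e) ^ 2 + (s * q + s ^ 2 * f) ^ 2 =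
      (1 + s ^ 2) ^ 2) → p = 0 ∧ q ^ 2 + 2 * e = 2 := by
    intro p q hs
    have e1 := hs 1
    have e2 := hs (-1)
    have e3 := hs 2
    have e4 := hs (-2)
    have hp : p = 0 := by linear_combination (1 / 3) * (e1 - e2) - (1 / 24) * (e3 - e4)
    refine ⟨hp, ?_⟩
    subst hp
    linear_combination (1 / 2) * (e1 + e2) - hef
  obtain ⟨hp1, hq1⟩ := line p₁ q₁ fun s => by linear_combination h s 0
  obtain ⟨hp2, hq2⟩ := line p₂ q₂ fun s => by linear_combination h 0 s
  have he : e = 1 := by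
    by_cases h0 : q₁ = 0
    · rw [h0] at hq1; linarith
    -- At this point the linear term `x * q₁ + y * q₂` cancels.
    · have h1 := h q₂ (-q₁)
      have hr : 0 < q₂ ^ 2 + q₁ ^ 2 := by positivity
      rw [hp1, hp2] at h1
      have : (q₂ ^ 2 + q₁ ^ 2) * (e - 1) = 0 := by
        linear_combination (1 / 2) * h1 - (1 / 2) * (q₂ ^ 2 + q₁ ^ 2) ^ 2 * hef
      rcases mul_eq_zero.1 this with h | h <;> linarith
  subst he
  refine ⟨⟨rfl, ?_⟩, ⟨hp1, ?_⟩, hp2, ?_⟩ <;> refine pow_eq_zero_iff two_ne_zero |>.1 ?_ <;> linarith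

/-- This is the condition met by a functional on the projections onto the lines spanned by `e_k + t
e_l`, normalized at `E_kk`. Squaring and writing `t = x + iy` gives the preceding real identity. -/
theorem eq_one_and_eq_zero_of_norm_quadratic {a b c : ℂ} (hc : ‖c‖ = 1)
    (h : ∀ t : ℂ, ‖1 + star t * a + t * b + ((‖t‖ ^ 2 : ℝ) : ℂ) * c‖ = 1 + ‖t‖ ^ 2) :
    c = 1 ∧ a = 0 ∧ b = 0 := by
  have hsq : ∀ z : ℂ, ‖z‖ ^ 2 = z.re ^ 2 + z.im ^ 2 := fun z => by
    rw [← Complex.normSq_eq_norm_sq, Complex.normSq_apply]; ring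
  have hc2 : c.re ^ 2 + c.im ^ 2 = 1 := by rw [← hsq, hc, one_pow]
  obtain ⟨⟨h1, h2⟩, ⟨h3, h4⟩, h5, h6⟩ := eq_one_and_eq_zero_of_quadratic (p₁ := a.re + b.re)
    (q₁ := a.im + b.im) (p₂ := a.im - b.im) (q₂ := b.re - a.re) hc2 fun x y => by
      have := congrArg (· ^ 2) (h ⟨x, y⟩)
      have hxy : ‖(⟨x, y⟩ : ℂ)‖ ^ 2 = x ^ 2 + y ^ 2 := hsq _
      simp only [hxy] at this
      rw [hsq] at this
      rw [← this]
      simp only [Complex.add_re, Complex.add_im, Complex.ofReal_re, Complex.ofReal_im,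
        Complex.star_def, Complex.mul_re, Complex.mul_im, Complex.conj_re, Complex.conj_im,
        Complex.one_re, Complex.one_im]
      ring
  refine ⟨Complex.ext h1 h2, Complex.ext ?_ ?_, Complex.ext ?_ ?_⟩ <;> simp <;> linarith

variable {ι : Type*} [Fintype ι] [DecidableEq ι]

theorem exists_unitary_conj_single_eq_vecMulVec {v : ι → ℂ} (hv : star v ⬝ᵥ v = 1) (i : ι) :
    ∃ X ∈ Matrix.unitaryGroup ι ℂ,
      X * Matrix.single i i 1 * Xᴴ = Matrix.vecMulVec v (star v) := by
  have hn : ‖WithLp.toLp 2 v‖ = 1 := by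
    rw [EuclideanSpace.norm_eq]
    have : ∑ i, ‖v i‖ ^ 2 = 1 := by
      have := (star_dotProduct_self_eq v).symm.trans hv
      exact_mod_cast this
    simp [this]
  obtain ⟨b, hb⟩ := Orthonormal.exists_orthonormalBasis_extension_of_card_eq (𝕜 := ℂ)
    (E := EuclideanSpace ℂ ι) (ι := ι) (by simp) (v := fun _ => WithLp.toLp 2 v) (s := {i})
    (by
      rw [orthonormal_iff_ite]
      rintro ⟨a, rfl⟩ ⟨c, rfl⟩
      simp [Set.domRestrict, inner_self_eq_norm_sq_to_K, hn])
  have hbi : b i = WithLp.toLp 2 v := hb i rfl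
  refine ⟨(EuclideanSpace.basisFun ι ℂ).toBasis.toMatrix b.toBasis,
    (EuclideanSpace.basisFun ι ℂ).toMatrix_orthonormalBasis_mem_unitary b, ?_⟩
  ext x y
  simp [Matrix.mul_apply, Matrix.single_apply, Module.Basis.toMatrix_apply, hbi,
    Matrix.vecMulVec_apply, Finset.sum_ite_eq, ite_and]

theorem norm_apply_vecMulVec {τ : Matrix ι ι ℂ →ₗ[ℂ] ℂ}
    (h : ∀ X ∈ Matrix.unitaryGroup ι ℂ, ∀ i, ‖τ (X * Matrix.single i i 1 * Xᴴ)‖ = 1) (v : ι → ℂ) :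
    ‖τ (Matrix.vecMulVec v (star v))‖ = ∑ i, ‖v i‖ ^ 2 := by
  set s : ℝ := ∑ i, ‖v i‖ ^ 2 with hs
  have hs0 : 0 ≤ s := Finset.sum_nonneg fun _ _ => by positivity
  rcases hs0.eq_or_lt with h0 | hpos
  · have hu : v = 0 := by
      ext i
      have := (Finset.sum_eq_zero_iff_of_nonneg (fun i _ => by positivity)).1 (hs.symm.trans h0.symm)
        i (Finset.mem_univ i)
      simpa using this
    simp [hu, ← h0]
  · have hss : Real.sqrt s * Real.sqrt s = s := Real.mul_self_sqrt hs0
    have hne : Nonempty ι := by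
      by_contra hne
      rw [not_nonempty_iff] at hne
      simp [hs] at hpos
    obtain ⟨i⟩ := hne
    have hc : (((Real.sqrt s)⁻¹ : ℝ) : ℂ) * (((Real.sqrt s)⁻¹ : ℝ) : ℂ) = ((s⁻¹ : ℝ) : ℂ) := by
      rw [← Complex.ofReal_mul, ← mul_inv, hss]
    have hst : star ((((Real.sqrt s)⁻¹ : ℝ) : ℂ)) = (((Real.sqrt s)⁻¹ : ℝ) : ℂ) :=
      Complex.conj_ofReal _
    obtain ⟨X, hX, hXv⟩ := exists_unitary_conj_single_eq_vecMulVec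
      (v := (((Real.sqrt s)⁻¹ : ℝ) : ℂ) • v) (by
        rw [star_smul, smul_dotProduct, dotProduct_smul, smul_smul, hst, hc,
          star_dotProduct_self_eq, smul_eq_mul, ← Complex.ofReal_mul, ← hs,
          inv_mul_cancel₀ hpos.ne', Complex.ofReal_one]) i
    have := h X hX i
    rw [hXv, star_smul, Matrix.smul_vecMulVec, Matrix.vecMulVec_smul, smul_smul, hst, hc, map_smul,
      norm_smul, Complex.norm_real, Real.norm_of_nonneg (inv_nonneg.2 hs0),
      inv_mul_eq_one₀ hpos.ne'] at this
    exact this.symm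

/-- A linear functional of modulus one on all rank-one projections is a multiple of the trace. -/
theorem exists_eq_mul_trace [Nonempty ι] {τ : Matrix ι ι ℂ →ₗ[ℂ] ℂ}
    (h : ∀ X ∈ Matrix.unitaryGroup ι ℂ, ∀ i, ‖τ (X * Matrix.single i i 1 * Xᴴ)‖ = 1) :
    ∃ c : ℂ, ‖c‖ = 1 ∧ ∀ A, τ A = c * A.trace := by
  have hone : ∀ i, ‖τ (Matrix.single i i 1)‖ = 1 := fun i => by
    simpa using h 1 (one_mem _) i
  have key : ∀ k l, k ≠ l → τ (Matrix.single l l 1) = τ (Matrix.single k k 1) ∧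
      τ (Matrix.single k l 1) = 0 ∧ τ (Matrix.single l k 1) = 0 := by
    intro k l hkl
    set c := τ (Matrix.single k k 1) with hc
    have hcc : star c * c = 1 := by
      have := Complex.normSq_eq_conj_mul_self (z := c)
      rw [Complex.normSq_eq_norm_sq, hone k] at this
      simpa using this.symm
    have hc0 : star c ≠ 0 := left_ne_zero_of_mul_eq_one hcc
    obtain ⟨e1, e2, e3⟩ := eq_one_and_eq_zero_of_norm_quadratic
      (a := star c * τ (Matrix.single k l 1)) (b := star c * τ (Matrix.single l k 1))
      (c := star c * τ (Matrix.single l l 1))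
      (by rw [norm_mul, norm_star, hone k, hone l, one_mul]) (by
        intro t
        have hv := norm_apply_vecMulVec h (Pi.single k 1 + t • Pi.single l 1)
        have hE : Matrix.vecMulVec (Pi.single k 1 + t • Pi.single l (1 : ℂ))
            (star (Pi.single k 1 + t • Pi.single l (1 : ℂ))) =
            Matrix.single k k 1 + star t • Matrix.single k l 1 + t • Matrix.single l k 1 +
              ((‖t‖ ^ 2 : ℝ) : ℂ) • Matrix.single l l 1 := by
          have ht : t * star t = ((‖t‖ ^ 2 : ℝ) : ℂ) := by
            rw [← Complex.normSq_eq_norm_sq]; exact Complex.mul_conj t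
          rw [star_add, star_smul, ← Pi.single_star, ← Pi.single_star, Matrix.add_vecMulVec,
            Matrix.vecMulVec_add, Matrix.vecMulVec_add, Matrix.smul_vecMulVec,
            Matrix.smul_vecMulVec, Matrix.vecMulVec_smul, Matrix.vecMulVec_smul, smul_smul, ht]
          simp only [star_one, ← Matrix.single_eq_single_vecMulVec_single]
          abel
        have hS : ∑ i, ‖(Pi.single k 1 + t • Pi.single l (1 : ℂ) : ι → ℂ) i‖ ^ 2 = 1 + ‖t‖ ^ 2 := by
          rw [← Finset.sum_subset (Finset.subset_univ {k, l}), Finset.sum_pair hkl]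
          · simp [hkl, hkl.symm]
          · intro i _ hi
            simp only [Finset.mem_insert, Finset.mem_singleton, not_or] at hi
            simp [hi.1, hi.2]
        rw [hE, hS] at hv
        simp only [map_add, map_smul, smul_eq_mul, ← hc] at hv
        rw [← hv]
        have : 1 + star t * (star c * τ (Matrix.single k l 1)) +
            t * (star c * τ (Matrix.single l k 1)) +
            ((‖t‖ ^ 2 : ℝ) : ℂ) * (star c * τ (Matrix.single l l 1)) = star c *
            (c + star t * τ (Matrix.single k l 1) + t * τ (Matrix.single l k 1) +
              ((‖t‖ ^ 2 : ℝ) : ℂ) * τ (Matrix.single l l 1)) := by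
          linear_combination -hcc
        rw [this, norm_mul, norm_star, hone k, one_mul])
    exact ⟨mul_left_cancel₀ hc0 (e1.trans hcc.symm), (mul_eq_zero.1 e2).resolve_left hc0,
      (mul_eq_zero.1 e3).resolve_left hc0⟩
  obtain ⟨i₀⟩ := ‹Nonempty ι›
  refine ⟨τ (Matrix.single i₀ i₀ 1), hone i₀, fun A => ?_⟩
  have : τ = τ (Matrix.single i₀ i₀ 1) • Matrix.traceLinearMap ι ℂ ℂ := by
    refine Matrix.ext_linearMap ℂ fun i j => LinearMap.ext_ring ?_
    change τ (Matrix.single i j 1) = τ (Matrix.single i₀ i₀ 1) * (Matrix.single i j (1 : ℂ)).trace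
    by_cases hij : i = j
    · subst hij
      rw [Matrix.trace_single_eq_same, mul_one]
      by_cases hi : i₀ = i
      · rw [hi]
      · exact (key i₀ i hi).1
    · rw [Matrix.trace_single_eq_of_ne _ _ _ hij, mul_zero, (key i j hij).2.1]
  conv_lhs => rw [this]
  simp

end UnitFunctional

/-! ### Images of products of rank-one projections and of diagonal matrices. -/

section Product

variable {ι κ : Type*} [Fintype ι] [Fintype κ]

theorem conj_kronecker_conj (X A : Matrix ι ι ℂ) (Y B : Matrix κ κ ℂ) :
    (X * A * Xᴴ) ⊗ₖ (Y * B * Yᴴ) = (X ⊗ₖ Y) * (A ⊗ₖ B) * (X ⊗ₖ Y)ᴴ := by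
  rw [Matrix.conjTranspose_kronecker, Matrix.mul_kronecker_mul, Matrix.mul_kronecker_mul]

theorem numericalRadius_average_le [Nonempty ι] {A B : Matrix ι ι ℂ} (hA : numericalRadius A ≤ 1)
    (hB : numericalRadius B ≤ 1) : numericalRadius ((1 / 2 : ℂ) • (A + B)) ≤ 1 := by
  refine numericalRadius_le fun u => ?_
  have h4 : (0 : ℝ) ≤ ∑ i, ‖u i‖ ^ 2 := Finset.sum_nonneg fun _ _ => by positivity
  have hA' := norm_le_numericalRadius_mul A u
  have hB' := norm_le_numericalRadius_mul B u
  have hAB := norm_add_le (star u ⬝ᵥ (A *ᵥ u)) (star u ⬝ᵥ (B *ᵥ u))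
  rw [Matrix.smul_mulVec, dotProduct_smul, Matrix.add_mulVec, dotProduct_add, norm_smul]
  have : ‖(1 / 2 : ℂ)‖ = 1 / 2 := by simp
  rw [this]
  nlinarith

theorem norm_single_add_smul_single_le {σ : Type*} [DecidableEq σ] {i k : σ} (hik : i ≠ k) {α : ℂ}
    (hα : ‖α‖ ≤ 1) (x : σ) : ‖(Pi.single i 1 + α • Pi.single k (1 : ℂ) : σ → ℂ) x‖ ≤ 1 := by
  by_cases hi : x = i
  · subst hi; simp [hik]
  · by_cases hk : x = k
    · subst hk; simpa [hi] using hα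
    · simp [hi, hk]

variable [DecidableEq ι] [DecidableEq κ]

variable {φ : Matrix (ι × κ) (ι × κ) ℂ →ₗ[ℂ] Matrix (ι × κ) (ι × κ) ℂ}

/-- The hypotheses of `exists_unitary_conj_single` are checked on products of diagonal matrices with
entries in the unit disc, whose numerical radius is at most one. -/
theorem exists_unitary_apply_conj_single [Nonempty ι] [Nonempty κ]
    (hφ : ∀ (A : Matrix ι ι ℂ) (B : Matrix κ κ ℂ),
      numericalRadius (φ (A ⊗ₖ B)) = numericalRadius (A ⊗ₖ B))
    {X : Matrix ι ι ℂ} (hX : X ∈ Matrix.unitaryGroup ι ℂ)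
    {Y : Matrix κ κ ℂ} (hY : Y ∈ Matrix.unitaryGroup κ ℂ) :
    ∃ W ∈ Matrix.unitaryGroup (ι × κ) ℂ, ∃ ξ : ι × κ → ℂ, (∀ p, ‖ξ p‖ = 1) ∧
      ∀ p : ι × κ, φ ((X * Matrix.single p.1 p.1 1 * Xᴴ) ⊗ₖ (Y * Matrix.single p.2 p.2 1 * Yᴴ)) =
        ξ p • (W * Matrix.single p p 1 * Wᴴ) := by
  have hF : ∀ (A : Matrix ι ι ℂ) (B : Matrix κ κ ℂ),
      numericalRadius (φ ((X * A * Xᴴ) ⊗ₖ (Y * B * Yᴴ))) = numericalRadius (A ⊗ₖ B) := by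
    intro A B
    rw [hφ, conj_kronecker_conj, numericalRadius_conj (Matrix.kronecker_mem_unitary hX hY)]
  have hdiag : ∀ (a : ι → ℂ) (b : κ → ℂ), (∀ i, ‖a i‖ ≤ 1) → (∀ j, ‖b j‖ ≤ 1) →
      numericalRadius (φ ((X * Matrix.diagonal a * Xᴴ) ⊗ₖ (Y * Matrix.diagonal b * Yᴴ))) ≤ 1 := by
    intro a b ha hb
    rw [hF, Matrix.diagonal_kronecker_diagonal]
    refine numericalRadius_diagonal_le fun p => ?_
    rw [norm_mul]
    exact mul_le_one₀ (ha _) (norm_nonneg _) (hb _)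
  have hs : ∀ {i : ι} (x : ι), ‖(Pi.single i 1 : ι → ℂ) x‖ ≤ 1 := by
    intro i x
    by_cases h : x = i
    · subst h; simp
    · simp [h]
  have hs' : ∀ {i : κ} (x : κ), ‖(Pi.single i 1 : κ → ℂ) x‖ ≤ 1 := by
    intro i x
    by_cases h : x = i
    · subst h; simp
    · simp [h]
  have hd : ∀ (i k : ι) (α : ℂ), Matrix.diagonal (Pi.single i 1 + α • Pi.single k (1 : ℂ)) =
      Matrix.single i i 1 + α • Matrix.single k k 1 := by
    intro i k α
    rw [← Matrix.diagonal_single, ← Matrix.diagonal_single, ← Matrix.diagonal_smul,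
      Matrix.diagonal_add]
    rfl
  have hd' : ∀ (i k : κ) (α : ℂ), Matrix.diagonal (Pi.single i 1 + α • Pi.single k (1 : ℂ)) =
      Matrix.single i i 1 + α • Matrix.single k k 1 := by
    intro i k α
    rw [← Matrix.diagonal_single, ← Matrix.diagonal_single, ← Matrix.diagonal_smul,
      Matrix.diagonal_add]
    rfl
  refine exists_unitary_conj_single _ (fun p => ?_) ?_
  · rw [hF, Matrix.single_kronecker_single, one_mul]
    refine le_antisymm ?_ (one_le_numericalRadius_single p)
    rw [← Matrix.diagonal_single]
    refine numericalRadius_diagonal_le fun x => ?_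
    by_cases h : x = p
    · subst h; simp
    · simp [h]
  · rintro ⟨i, j⟩ ⟨k, l⟩ hpq θ hθ
    dsimp only
    by_cases hik : i = k
    · subst hik
      have hjl : j ≠ l := fun h => hpq (by rw [h])
      have := hdiag (Pi.single i 1) (Pi.single j 1 + θ • Pi.single l 1) hs
        (norm_single_add_smul_single_le hjl hθ.le)
      rw [hd', Matrix.diagonal_single] at this
      simpa only [mul_add, add_mul, Matrix.mul_smul, Matrix.smul_mul, Matrix.kronecker_add,
        Matrix.kronecker_smul, map_add, map_smul] using this
    · by_cases hjl : j = l
      · subst hjl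
        have := hdiag (Pi.single i 1 + θ • Pi.single k 1) (Pi.single j 1)
          (norm_single_add_smul_single_le hik hθ.le) hs'
        rw [hd, Matrix.diagonal_single] at this
        simpa only [mul_add, add_mul, Matrix.mul_smul, Matrix.smul_mul, Matrix.add_kronecker,
          Matrix.smul_kronecker, map_add, map_smul] using this
      -- When both indices differ, `E_ii ⊗ E_jj + θ E_kk ⊗ E_ll` is not an elementary tensor, but it
      -- is the average of `(E_ii + E_kk) ⊗ (E_jj + θ E_ll)` and `(E_ii - E_kk) ⊗ (E_jj - θ E_ll)`.
      · have h1 := hdiag (Pi.single i 1 + (1 : ℂ) • Pi.single k 1) (Pi.single j 1 + θ • Pi.single l 1)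
          (norm_single_add_smul_single_le hik (by simp)) (norm_single_add_smul_single_le hjl hθ.le)
        have h2 := hdiag (Pi.single i 1 + (-1 : ℂ) • Pi.single k 1)
          (Pi.single j 1 + (-θ) • Pi.single l 1)
          (norm_single_add_smul_single_le hik (by simp))
          (norm_single_add_smul_single_le hjl (by rw [norm_neg, hθ]))
        have := numericalRadius_average_le h1 h2
        rw [hd, hd, hd', hd'] at this
        simp only [mul_add, add_mul, Matrix.mul_smul, Matrix.smul_mul, Matrix.add_kronecker,
          Matrix.smul_kronecker, Matrix.kronecker_add, Matrix.kronecker_smul, map_add,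
          map_smul] at this
        convert this using 2
        module

theorem trace_conj_single {W : Matrix ι ι ℂ} (hW : W ∈ Matrix.unitaryGroup ι ℂ) (i : ι) :
    (W * Matrix.single i i 1 * Wᴴ).trace = 1 := by
  rw [Matrix.trace_mul_cycle, ← Matrix.star_eq_conjTranspose, Matrix.mem_unitaryGroup_iff'.1 hW,
    one_mul, Matrix.trace_single_eq_same]

theorem conj_diagonal_eq_sum (W : Matrix ι ι ℂ) (d : ι → ℂ) :
    W * Matrix.diagonal d * Wᴴ = ∑ i, d i • (W * Matrix.single i i 1 * Wᴴ) := by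
  rw [← Matrix.sum_single_eq_diagonal, Finset.mul_sum, Finset.sum_mul]
  refine Finset.sum_congr rfl fun i _ => ?_
  rw [← Matrix.smul_mul, ← Matrix.mul_smul, Matrix.smul_single, smul_eq_mul, mul_one]

/-- The phases found so far depend on the bases and on the index; each is the trace of an image. The
trace form is a multiple of the trace in either variable separately, so it takes one value `c` on
all products of rank-one projections. -/
theorem exists_unitary_apply_conj_diagonal [Nonempty ι] [Nonempty κ]
    (hφ : ∀ (A : Matrix ι ι ℂ) (B : Matrix κ κ ℂ),
      numericalRadius (φ (A ⊗ₖ B)) = numericalRadius (A ⊗ₖ B)) :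
    ∃ ξ : ℂ, ‖ξ‖ = 1 ∧ ∀ X ∈ Matrix.unitaryGroup ι ℂ, ∀ Y ∈ Matrix.unitaryGroup κ ℂ,
      ∃ W ∈ Matrix.unitaryGroup (ι × κ) ℂ, ∀ (a : ι → ℂ) (b : κ → ℂ),
        φ ((X * Matrix.diagonal a * Xᴴ) ⊗ₖ (Y * Matrix.diagonal b * Yᴴ)) =
          ξ • (W * (Matrix.diagonal a ⊗ₖ Matrix.diagonal b) * Wᴴ) := by
  set τ : Matrix ι ι ℂ →ₗ[ℂ] Matrix κ κ ℂ →ₗ[ℂ] ℂ :=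
    (Matrix.kroneckerBilinear (R := ℂ)).compr₂ (Matrix.traceLinearMap (ι × κ) ℂ ℂ ∘ₗ φ) with hτ
  have hτa : ∀ A B, τ A B = (φ (A ⊗ₖ B)).trace := fun A B => rfl
  have hunit : ∀ X ∈ Matrix.unitaryGroup ι ℂ, ∀ Y ∈ Matrix.unitaryGroup κ ℂ, ∀ i j,
      ‖τ (X * Matrix.single i i 1 * Xᴴ) (Y * Matrix.single j j 1 * Yᴴ)‖ = 1 := by
    intro X hX Y hY i j
    obtain ⟨W, hW, ξ, hξ, h⟩ := exists_unitary_apply_conj_single hφ hX hY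
    rw [hτa, h (i, j), Matrix.trace_smul, trace_conj_single hW, smul_eq_mul, mul_one, hξ]
  obtain ⟨i₀⟩ := ‹Nonempty ι›
  obtain ⟨c, hc, hcτ⟩ := exists_eq_mul_trace (τ := τ (Matrix.single i₀ i₀ 1)) fun Y hY j => by
    simpa using hunit 1 (one_mem _) Y hY i₀ j
  have hconst : ∀ X ∈ Matrix.unitaryGroup ι ℂ, ∀ Y ∈ Matrix.unitaryGroup κ ℂ, ∀ i j,
      τ (X * Matrix.single i i 1 * Xᴴ) (Y * Matrix.single j j 1 * Yᴴ) = c := by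
    intro X hX Y hY i j
    obtain ⟨d, hd, hdτ⟩ := exists_eq_mul_trace (τ := τ.flip (Y * Matrix.single j j 1 * Yᴴ))
      fun X hX i => hunit X hX Y hY i j
    simp only [LinearMap.flip_apply] at hdτ
    have h1 := hcτ (Y * Matrix.single j j 1 * Yᴴ)
    rw [hdτ, trace_conj_single hY, Matrix.trace_single_eq_same, mul_one, mul_one] at h1
    rw [hdτ, trace_conj_single hX, mul_one, h1]
  refine ⟨c, hc, fun X hX Y hY => ?_⟩
  obtain ⟨W, hW, ξ, hξ, h⟩ := exists_unitary_apply_conj_single hφ hX hY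
  have hξc : ∀ p, ξ p = c := by
    intro p
    rw [← hconst X hX Y hY p.1 p.2, hτa, h p, Matrix.trace_smul, trace_conj_single hW, smul_eq_mul,
      mul_one]
  refine ⟨W, hW, fun a b => ?_⟩
  have e1 : (X * Matrix.diagonal a * Xᴴ) ⊗ₖ (Y * Matrix.diagonal b * Yᴴ) =
      ∑ i, ∑ j, (a i * b j) • ((X * Matrix.single i i 1 * Xᴴ) ⊗ₖ (Y * Matrix.single j j 1 * Yᴴ)) := by
    rw [conj_diagonal_eq_sum, conj_diagonal_eq_sum]
    change Matrix.kroneckerBilinear (R := ℂ) _ _ = _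
    rw [LinearMap.map_sum₂]
    refine Finset.sum_congr rfl fun i _ => ?_
    rw [map_sum]
    refine Finset.sum_congr rfl fun j _ => ?_
    rw [map_smul, LinearMap.map_smul₂, smul_smul, mul_comm]
    rfl
  rw [e1, Matrix.diagonal_kronecker_diagonal, conj_diagonal_eq_sum, Fintype.sum_prod_type, map_sum,
    Finset.smul_sum]
  refine Finset.sum_congr rfl fun i _ => ?_
  rw [map_sum, Finset.smul_sum]
  refine Finset.sum_congr rfl fun j _ => ?_
  rw [map_smul, h (i, j), hξc, smul_comm]

end Product

/-! ### Jordan homomorphisms of matrix algebras. -/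

section Jordan

variable {ι κ R : Type*} [Fintype ι] [DecidableEq ι] [Fintype κ] [DecidableEq κ]
  [Ring R] [Algebra ℂ R]

/-- A unital linear map on a matrix algebra preserving the Jordan product. -/
structure IsJordanHom (ψ : Matrix ι ι ℂ →ₗ[ℂ] R) : Prop where
  map_one : ψ 1 = 1
  map_jordan : ∀ A B, ψ (A * B + B * A) = ψ A * ψ B + ψ B * ψ A

namespace IsJordanHom

variable {ψ : Matrix ι ι ℂ →ₗ[ℂ] R}

theorem eq_zero_of_add_self {x : R} (h : x + x = 0) : x = 0 := by
  have : (2 : ℂ) • x = 0 := by rw [two_smul, h]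
  exact (smul_eq_zero_iff_right two_ne_zero).1 this

theorem map_sq (hψ : IsJordanHom ψ) (A : Matrix ι ι ℂ) : ψ (A * A) = ψ A * ψ A := by
  have := hψ.map_jordan A A
  rw [map_add] at this
  refine sub_eq_zero.1 (eq_zero_of_add_self ?_)
  rw [sub_add_sub_comm, this, sub_self]

theorem transpose (hψ : IsJordanHom ψ) :
    IsJordanHom (ψ ∘ₗ (Matrix.transposeLinearEquiv ι ι ℂ ℂ).toLinearMap) where
  map_one := by simpa using hψ.map_one
  map_jordan A B := by simpa [add_comm] using hψ.map_jordan Aᵀ Bᵀ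

theorem diag_mul_self (hψ : IsJordanHom ψ) (i : ι) :
    ψ (Matrix.single i i 1) * ψ (Matrix.single i i 1) = ψ (Matrix.single i i 1) := by
  rw [← hψ.map_sq, Matrix.single_mul_single_same, one_mul]

/-- Multiplying `pq + qp = 0` by the idempotent `p` on either side gives `pq = -pqp = qp`. -/
theorem diag_mul_diag (hψ : IsJordanHom ψ) {i j : ι} (hij : i ≠ j) :
    ψ (Matrix.single i i 1) * ψ (Matrix.single j j 1) = 0 := by
  have h := hψ.map_jordan (Matrix.single i i 1) (Matrix.single j j 1)
  rw [Matrix.single_mul_single_of_ne _ _ _ _ hij, Matrix.single_mul_single_of_ne _ _ _ _ hij.symm,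
    add_zero, map_zero] at h
  have hi := hψ.diag_mul_self i
  set p := ψ (Matrix.single i i 1)
  set q := ψ (Matrix.single j j 1)
  have h1 : p * q + p * q * p = 0 := by
    calc p * q + p * q * p = (p * p) * q + p * q * p := by rw [hi]
      _ = p * (p * q + q * p) := by noncomm_ring
      _ = 0 := by rw [← h, mul_zero]
  have h2 : p * q * p + q * p = 0 := by
    calc p * q * p + q * p = p * q * p + q * (p * p) := by rw [hi]
      _ = (p * q + q * p) * p := by noncomm_ring
      _ = 0 := by rw [← h, zero_mul]
  have h3 : p * q = q * p := by
    rw [add_comm] at h2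
    rw [eq_neg_of_add_eq_zero_left h1, eq_neg_of_add_eq_zero_left h2]
  exact eq_zero_of_add_self (by rw [h]; nth_rewrite 2 [h3]; rfl)

theorem sum_diag (hψ : IsJordanHom ψ) : ∑ i, ψ (Matrix.single i i 1) = 1 := by
  rw [← map_sum, Matrix.sum_single_one, hψ.map_one]

theorem add_eq (hψ : IsJordanHom ψ) {i j : ι} (hij : i ≠ j) :
    ψ (Matrix.single i j 1) = ψ (Matrix.single i i 1) * ψ (Matrix.single i j 1) +
      ψ (Matrix.single i j 1) * ψ (Matrix.single i i 1) := by
  rw [← hψ.map_jordan, Matrix.single_mul_single_same,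
    Matrix.single_mul_single_of_ne _ _ _ _ hij.symm, add_zero, one_mul]

theorem add_eq' (hψ : IsJordanHom ψ) {i j : ι} (hij : i ≠ j) :
    ψ (Matrix.single i j 1) = ψ (Matrix.single j j 1) * ψ (Matrix.single i j 1) +
      ψ (Matrix.single i j 1) * ψ (Matrix.single j j 1) := by
  rw [← hψ.map_jordan, Matrix.single_mul_single_same,
    Matrix.single_mul_single_of_ne _ _ _ _ hij.symm, zero_add, one_mul]

/-- With `p`, `q` the images of `E_ii`, `E_jj` and `s` that of `E_ij`, both sides equal the corner
`psq`. Together with `col_mul` this splits `s` as `psq + qsp`: the first corner is the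
multiplicative part, the second the anti-multiplicative one. -/
theorem row_mul (hψ : IsJordanHom ψ) {i j : ι} (hij : i ≠ j) :
    ψ (Matrix.single i i 1) * ψ (Matrix.single i j 1) =
      ψ (Matrix.single i j 1) * ψ (Matrix.single j j 1) := by
  have h1 := hψ.add_eq hij
  have h2 := hψ.add_eq' hij
  have h3 := hψ.diag_mul_diag hij
  set p := ψ (Matrix.single i i 1)
  set q := ψ (Matrix.single j j 1)
  set s := ψ (Matrix.single i j 1)
  calc p * s = p * (q * s + s * q) := by rw [← h2]
    _ = p * s * q := by rw [mul_add, ← mul_assoc, h3, zero_mul, zero_add, mul_assoc]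
    _ = (p * s + s * p) * q := by rw [add_mul, mul_assoc s p q, h3, mul_zero, add_zero]
    _ = s * q := by rw [← h1]

theorem col_mul (hψ : IsJordanHom ψ) {i j : ι} (hij : i ≠ j) :
    ψ (Matrix.single j j 1) * ψ (Matrix.single i j 1) =
      ψ (Matrix.single i j 1) * ψ (Matrix.single i i 1) := by
  have h1 := hψ.add_eq hij
  have h2 := hψ.add_eq' hij
  rw [← hψ.row_mul hij] at h2
  rw [add_comm] at h2
  exact (add_left_cancel (h1.symm.trans h2)).symm

theorem eq_add (hψ : IsJordanHom ψ) {i j : ι} (hij : i ≠ j) :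
    ψ (Matrix.single i j 1) = ψ (Matrix.single i i 1) * ψ (Matrix.single i j 1) +
      ψ (Matrix.single j j 1) * ψ (Matrix.single i j 1) := by
  rw [hψ.col_mul hij]; exact hψ.add_eq hij

theorem offDiag_mul_self (hψ : IsJordanHom ψ) {i j : ι} (hij : i ≠ j) :
    ψ (Matrix.single i j 1) * ψ (Matrix.single i j 1) = 0 := by
  rw [← hψ.map_sq, Matrix.single_mul_single_of_ne _ _ _ _ hij.symm, map_zero]

theorem offDiag_jordan (hψ : IsJordanHom ψ) (i j : ι) :
    ψ (Matrix.single i j 1) * ψ (Matrix.single j i 1) +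
      ψ (Matrix.single j i 1) * ψ (Matrix.single i j 1) =
      ψ (Matrix.single i i 1) + ψ (Matrix.single j j 1) := by
  rw [← hψ.map_jordan, Matrix.single_mul_single_same, Matrix.single_mul_single_same, map_add,
    one_mul]

theorem offDiag_jordan_of_ne (hψ : IsJordanHom ψ) {i k : ι} (hik : i ≠ k) (j : ι) :
    ψ (Matrix.single i j 1) * ψ (Matrix.single j k 1) +
      ψ (Matrix.single j k 1) * ψ (Matrix.single i j 1) = ψ (Matrix.single i k 1) := by
  rw [← hψ.map_jordan, Matrix.single_mul_single_same, Matrix.single_mul_single_of_ne _ _ _ _ hik.symm,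
    add_zero, one_mul]

/-- Without the anti-multiplicative corners, images of matrix units with mismatched inner indices
multiply to zero. One of the two terms in each Jordan relation then disappears, leaving the
multiplication table of matrix units. -/
theorem map_mul_of_col_mul_eq_zero (hψ : IsJordanHom ψ)
    (h : ∀ i j, i ≠ j → ψ (Matrix.single j j 1) * ψ (Matrix.single i j 1) = 0) (A B) :
    ψ (A * B) = ψ A * ψ B := by
  have hl : ∀ i j, ψ (Matrix.single i i 1) * ψ (Matrix.single i j 1) = ψ (Matrix.single i j 1) := by
    intro i j
    by_cases hij : i = j
    · subst hij; exact hψ.diag_mul_self i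
    · have := hψ.eq_add hij
      rw [h i j hij, add_zero] at this
      exact this.symm
  have hr : ∀ i j, ψ (Matrix.single i j 1) * ψ (Matrix.single j j 1) = ψ (Matrix.single i j 1) := by
    intro i j
    by_cases hij : i = j
    · subst hij; exact hψ.diag_mul_self i
    · rw [← hψ.row_mul hij, hl]
  have hne : ∀ i j k l, j ≠ k → ψ (Matrix.single i j 1) * ψ (Matrix.single k l 1) = 0 := by
    intro i j k l hjk
    rw [← hr i j, ← hl k l, mul_assoc, ← mul_assoc _ (ψ (Matrix.single k k 1)),
      hψ.diag_mul_diag hjk, zero_mul, mul_zero]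
  have key : (LinearMap.mul ℂ (Matrix ι ι ℂ)).compr₂ ψ = (LinearMap.mul ℂ R).compl₁₂ ψ ψ := by
    refine Matrix.ext_linearMap ℂ fun i j => LinearMap.ext_ring
      (Matrix.ext_linearMap ℂ fun k l => LinearMap.ext_ring ?_)
    change ψ (Matrix.single i j 1 * Matrix.single k l 1) =
      ψ (Matrix.single i j 1) * ψ (Matrix.single k l 1)
    by_cases hjk : j = k
    · subst hjk
      rw [Matrix.single_mul_single_same, one_mul]
      by_cases hij : i = j
      · subst hij; rw [hl]
      by_cases hil : i = l
      · subst hil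
        have := congrArg (ψ (Matrix.single i i 1) * ·) (hψ.offDiag_jordan i j)
        simp only [mul_add] at this
        rw [← mul_assoc, ← mul_assoc, hl, hne i i j i hij, zero_mul, add_zero,
          hψ.diag_mul_self, hψ.diag_mul_diag hij, add_zero] at this
        exact this.symm
      · have := hψ.offDiag_jordan_of_ne hil j
        rw [hne j l i j (Ne.symm hil), add_zero] at this
        exact this.symm
    · rw [hne i j k l hjk, Matrix.single_mul_single_of_ne _ _ _ _ hjk, map_zero]
  exact LinearMap.congr_fun₂ key A B

/-- A Jordan homomorphism whose off-diagonal matrix units have only one of their two possible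
corners is multiplicative or anti-multiplicative. -/
theorem map_mul_or_map_mul_rev (hψ : IsJordanHom ψ) (h0 : ∀ i, ψ (Matrix.single i i 1) ≠ 0)
    (h : ∀ i j, i ≠ j → ψ (Matrix.single j j 1) * ψ (Matrix.single i j 1) = 0 ∨
      ψ (Matrix.single i i 1) * ψ (Matrix.single i j 1) = 0) :
    (∀ A B, ψ (A * B) = ψ A * ψ B) ∨ ∀ A B, ψ (A * B) = ψ B * ψ A := by
  have hadd : ∀ i j, i ≠ j → ψ (Matrix.single i i 1) + ψ (Matrix.single j j 1) ≠ 0 := by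
    intro i j hij he
    have := congrArg (ψ (Matrix.single i i 1) * ·) he
    simp only [mul_add, mul_zero] at this
    rw [hψ.diag_mul_self, hψ.diag_mul_diag hij, add_zero] at this
    exact h0 i this
  -- The types of `E_ij` and `E_jk` cannot be anti-multiplicative and multiplicative respectively:
  -- their images would have zero product in both orders, against the Jordan relations. Hence one
  -- anti-multiplicative unit propagates its type to all the others.
  have link : ∀ i j k, i ≠ j → j ≠ k → ψ (Matrix.single i i 1) * ψ (Matrix.single i j 1) = 0 →
      ψ (Matrix.single k k 1) * ψ (Matrix.single j k 1) = 0 → False := by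
    intro i j k hij hjk ha hh
    have e1 : ψ (Matrix.single i j 1) * ψ (Matrix.single j k 1) = 0 := by
      rw [hψ.eq_add hjk, hh, add_zero, ← mul_assoc, ← hψ.row_mul hij, ha, zero_mul]
    have e2 : ψ (Matrix.single j k 1) * ψ (Matrix.single i j 1) = 0 := by
      rw [hψ.eq_add hij, ha, zero_add, ← mul_assoc, ← hψ.col_mul hjk, hh, zero_mul]
    by_cases hik : i = k
    · subst hik
      have := hψ.offDiag_jordan i j
      rw [e1, e2, add_zero] at this
      exact hadd i j hij this.symm
    · have := hψ.offDiag_jordan_of_ne hik j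
      rw [e1, e2, add_zero] at this
      have h2 := hψ.offDiag_jordan i k
      rw [← this, zero_mul, mul_zero, add_zero] at h2
      exact hadd i k hik h2.symm
  by_cases hall : ∀ i j, i ≠ j → ψ (Matrix.single j j 1) * ψ (Matrix.single i j 1) = 0
  · exact Or.inl (hψ.map_mul_of_col_mul_eq_zero hall)
  · right
    push Not at hall
    obtain ⟨i, j, hij, hne⟩ := hall
    have hanti := (h i j hij).resolve_left hne
    have hall' : ∀ k l, k ≠ l → ψ (Matrix.single k k 1) * ψ (Matrix.single k l 1) = 0 := by
      intro k l hkl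
      refine (h k l hkl).resolve_left fun hh => ?_
      by_cases hjk : j = k
      · subst hjk; exact link i j l hij hkl hanti hh
      · rcases h j k hjk with h' | h'
        · exact link i j k hij hjk hanti h'
        · exact link j k l hjk hkl h' hh
    have hmul := hψ.transpose.map_mul_of_col_mul_eq_zero fun i j hij => by
      simpa using hall' j i hij.symm
    intro A B
    simpa using hmul Bᵀ Aᵀ

/-- Write `p`, `q`, `s`, `s'` for the images of `E_ii`, `E_jj`, `E_ij`, `E_ji`, and recall `s² = 0`.
If `c = 0`, then `p = ps's`, so `ps = ps's² = 0`. Otherwise `c qs = s(pss') = qs²s' = 0`. -/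
theorem corner_eq_zero (hψ : IsJordanHom ψ) {i j : ι} (hij : i ≠ j) {c : ℂ}
    (hc : ψ (Matrix.single i i 1) * (ψ (Matrix.single i j 1) * ψ (Matrix.single j i 1)) =
      c • ψ (Matrix.single i i 1)) :
    ψ (Matrix.single j j 1) * ψ (Matrix.single i j 1) = 0 ∨
      ψ (Matrix.single i i 1) * ψ (Matrix.single i j 1) = 0 := by
  by_cases hc0 : c = 0
  · right
    have h1 := congrArg (ψ (Matrix.single i i 1) * ·) (hψ.offDiag_jordan i j)
    simp only [mul_add] at h1
    rw [hc, hc0, zero_smul, zero_add, hψ.diag_mul_self, hψ.diag_mul_diag hij, add_zero] at h1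
    rw [← h1, mul_assoc, mul_assoc, hψ.offDiag_mul_self hij, mul_zero, mul_zero]
  · left
    have : c • (ψ (Matrix.single j j 1) * ψ (Matrix.single i j 1)) = 0 := by
      rw [hψ.col_mul hij, ← mul_smul_comm, ← hc, ← mul_assoc, ← hψ.col_mul hij, mul_assoc,
        ← mul_assoc (ψ (Matrix.single i j 1)), hψ.offDiag_mul_self hij, zero_mul, mul_zero]
    exact (smul_eq_zero_iff_right hc0).1 this

variable {ψ₂ : Matrix κ κ ℂ →ₗ[ℂ] R}

/-- If `ψ` and `ψ₂` commute and the products of their diagonal units are minimal idempotents, then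
the commutant of `ψ₂` is trivial in each corner of `ψ`. -/
theorem exists_eq_smul_of_commute [Nonempty κ] (hψ : IsJordanHom ψ) (hψ₂ : IsJordanHom ψ₂)
    (hcomm : ∀ A B, ψ A * ψ₂ B = ψ₂ B * ψ A)
    (h0 : ∀ i j, ψ (Matrix.single i i 1) * ψ₂ (Matrix.single j j 1) ≠ 0)
    (hmin : ∀ i j X, ∃ c : ℂ, (ψ (Matrix.single i i 1) * ψ₂ (Matrix.single j j 1)) * X *
      (ψ (Matrix.single i i 1) * ψ₂ (Matrix.single j j 1)) =
        c • (ψ (Matrix.single i i 1) * ψ₂ (Matrix.single j j 1)))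
    {i : ι} {Z : R} (hl : ψ (Matrix.single i i 1) * Z = Z) (hr : Z * ψ (Matrix.single i i 1) = Z)
    (hZ : ∀ B, Z * ψ₂ B = ψ₂ B * Z) : ∃ c : ℂ, Z = c • ψ (Matrix.single i i 1) := by
  have hcp := fun B => hcomm (Matrix.single i i 1) B
  choose c hc using fun j => hmin i j Z
  have hidem := hψ.diag_mul_self i
  set p := ψ (Matrix.single i i 1) with hp
  have hZP : ∀ j, Z * ψ₂ (Matrix.single j j 1) = c j • (p * ψ₂ (Matrix.single j j 1)) := by
    intro j
    rw [← hc j]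
    have hj := hψ₂.diag_mul_self j
    have hZj := hZ (Matrix.single j j 1)
    have hpj := hcp (Matrix.single j j 1)
    set P := ψ₂ (Matrix.single j j 1)
    calc Z * P = Z * (P * P) := by rw [hj]
      _ = (Z * P) * P := by rw [mul_assoc]
      _ = P * Z * P := by rw [hZj]
      _ = P * (p * Z * p) * P := by rw [hl, hr]
      _ = (P * p) * Z * (p * P) := by simp only [mul_assoc]
      _ = p * P * Z * (p * P) := by rw [hpj]
  -- Here `t = ψ₂(E_jl)` intertwines the corners `j` and `l` and commutes with `Z`. If the scalars
  -- differed, then `pt = 0`, whence `p(P + Q) = 0` and `pP = 0`.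
  have hcc : ∀ j l, c j = c l := by
    intro j l
    by_cases hjl : j = l
    · rw [hjl]
    by_contra hne
    have hsub : c j - c l ≠ 0 := sub_ne_zero.2 hne
    have h1 := hψ₂.row_mul hjl
    have h2 := hψ₂.col_mul hjl
    have h3 := hψ₂.eq_add hjl
    have h4 := hψ₂.offDiag_jordan j l
    have h5 := hψ₂.diag_mul_self j
    have h6 := hψ₂.diag_mul_diag (Ne.symm hjl)
    have h7 := hZP j
    have h8 := hZP l
    have h9 := hZ (Matrix.single j l 1)
    have h10 := hcp (Matrix.single j l 1)
    have h11 := hcp (Matrix.single l j 1)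
    have hne0 := h0 i j
    rw [← hp] at hne0
    set P := ψ₂ (Matrix.single j j 1)
    set Q := ψ₂ (Matrix.single l l 1)
    set t := ψ₂ (Matrix.single j l 1)
    set t' := ψ₂ (Matrix.single l j 1)
    have a1 : (c j - c l) • (p * P * t) = 0 := by
      rw [sub_smul, sub_eq_zero]
      calc c j • (p * P * t) = Z * P * t := by rw [h7, smul_mul_assoc]
        _ = Z * t * Q := by rw [mul_assoc, h1, mul_assoc]
        _ = t * (c l • (p * Q)) := by rw [h9, mul_assoc, h8]
        _ = c l • (p * P * t) := by rw [mul_smul_comm, ← mul_assoc, ← h10, mul_assoc, ← h1, mul_assoc]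
    have a2 : (c j - c l) • (p * Q * t) = 0 := by
      rw [sub_smul, sub_eq_zero, eq_comm]
      calc c l • (p * Q * t) = Z * Q * t := by rw [h8, smul_mul_assoc]
        _ = Z * t * P := by rw [mul_assoc, h2, mul_assoc]
        _ = t * (c j • (p * P)) := by rw [h9, mul_assoc, h7]
        _ = c j • (p * Q * t) := by rw [mul_smul_comm, ← mul_assoc, ← h10, mul_assoc, ← h2, mul_assoc]
    have b1 := (smul_eq_zero_iff_right hsub).1 a1
    have b2 := (smul_eq_zero_iff_right hsub).1 a2
    have b3 : p * t = 0 := by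
      rw [h3, mul_add, ← mul_assoc, ← mul_assoc, b1, b2, add_zero]
    have b4 : p * (P + Q) = 0 := by
      rw [← h4, mul_add, ← mul_assoc, b3, zero_mul, zero_add, ← mul_assoc, h11, mul_assoc, b3,
        mul_zero]
    apply hne0
    calc p * P = p * (P + Q) * P := by rw [mul_assoc, add_mul, h5, h6, add_zero]
      _ = 0 := by rw [b4, zero_mul]
  obtain ⟨j₀⟩ := ‹Nonempty κ›
  refine ⟨c j₀, ?_⟩
  calc Z = Z * ∑ j, ψ₂ (Matrix.single j j 1) := by rw [hψ₂.sum_diag, mul_one]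
    _ = ∑ j, c j₀ • (p * ψ₂ (Matrix.single j j 1)) := by
      rw [Finset.mul_sum]
      exact Finset.sum_congr rfl fun j _ => by rw [hZP j, hcc j j₀]
    _ = c j₀ • p := by rw [← Finset.smul_sum, ← Finset.mul_sum, hψ₂.sum_diag, mul_one]

/-- The element `ψ(E_ii)ψ(E_ij)ψ(E_ji)` lies in the corner of `ψ(E_ii)` and commutes with the range
of `ψ₂`, so it is a scalar there. By `corner_eq_zero` each off-diagonal unit has a single type. -/
theorem map_mul_or_map_mul_rev_of_commute [Nonempty κ] (hψ : IsJordanHom ψ) (hψ₂ : IsJordanHom ψ₂)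
    (hcomm : ∀ A B, ψ A * ψ₂ B = ψ₂ B * ψ A)
    (h0 : ∀ i j, ψ (Matrix.single i i 1) * ψ₂ (Matrix.single j j 1) ≠ 0)
    (hmin : ∀ i j X, ∃ c : ℂ, (ψ (Matrix.single i i 1) * ψ₂ (Matrix.single j j 1)) * X *
      (ψ (Matrix.single i i 1) * ψ₂ (Matrix.single j j 1)) =
        c • (ψ (Matrix.single i i 1) * ψ₂ (Matrix.single j j 1))) :
    (∀ A B, ψ (A * B) = ψ A * ψ B) ∨ ∀ A B, ψ (A * B) = ψ B * ψ A := by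
  obtain ⟨j₀⟩ := id ‹Nonempty κ›
  refine hψ.map_mul_or_map_mul_rev (fun i hi => h0 i j₀ (by rw [hi, zero_mul])) fun i j hij => ?_
  obtain ⟨c, hc⟩ := hψ.exists_eq_smul_of_commute hψ₂ hcomm h0 hmin (i := i)
    (Z := ψ (Matrix.single i i 1) * (ψ (Matrix.single i j 1) * ψ (Matrix.single j i 1)))
    (by rw [← mul_assoc, hψ.diag_mul_self])
    (by
      rw [mul_assoc, mul_assoc, ← hψ.row_mul hij.symm, ← mul_assoc (ψ (Matrix.single i j 1)),
        ← hψ.row_mul hij, ← mul_assoc, ← mul_assoc, hψ.diag_mul_self, mul_assoc])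
    (fun B => by
      rw [mul_assoc, mul_assoc, hcomm, ← mul_assoc (ψ (Matrix.single i j 1)), hcomm, ← mul_assoc,
        ← mul_assoc, hcomm]
      simp only [mul_assoc])
  exact hψ.corner_eq_zero hij hc

end IsJordanHom

end Jordan

/-! ### Systems of matrix units. -/

section MatrixUnits

variable {k : Type*} [Fintype k] [DecidableEq k]

/-- A self-adjoint system of matrix units of full size is unitarily similar to the standard one. -/
theorem exists_unitary_of_matrixUnits {e : k → k → Matrix k k ℂ}
    (hmul : ∀ p q r, e p q * e q r = e p r) (hzero : ∀ p q r s, q ≠ r → e p q * e r s = 0)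
    (hstar : ∀ p q, (e p q)ᴴ = e q p) {p₀ : k} (h0 : e p₀ p₀ ≠ 0) :
    ∃ U ∈ Matrix.unitaryGroup k ℂ, ∀ p q, e p q = U * Matrix.single p q 1 * Uᴴ := by
  obtain ⟨v, hv, hvv⟩ : ∃ v : k → ℂ, e p₀ p₀ *ᵥ v = v ∧ star v ⬝ᵥ v = 1 := by
    obtain ⟨w, hw⟩ : ∃ w, e p₀ p₀ *ᵥ w ≠ 0 := by
      by_contra! hcon
      exact h0 (Matrix.ext_of_mulVec_single fun i => by rw [hcon, Matrix.zero_mulVec])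
    set x := e p₀ p₀ *ᵥ w with hx
    have hex : e p₀ p₀ *ᵥ x = x := by rw [hx, Matrix.mulVec_mulVec, hmul]
    set s : ℝ := ∑ i, ‖x i‖ ^ 2 with hs
    have hs0 : 0 ≤ s := Finset.sum_nonneg fun _ _ => by positivity
    have hpos : 0 < s := by
      refine hs0.lt_of_ne fun h => hw ?_
      ext i
      have := (Finset.sum_eq_zero_iff_of_nonneg (fun i _ => by positivity)).1 (hs.symm.trans h.symm)
        i (Finset.mem_univ i)
      simpa using this
    have hss : Real.sqrt s * Real.sqrt s = s := Real.mul_self_sqrt hs0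
    refine ⟨(((Real.sqrt s)⁻¹ : ℝ) : ℂ) • x, by rw [Matrix.mulVec_smul, hex], ?_⟩
    have hst : star ((((Real.sqrt s)⁻¹ : ℝ) : ℂ)) = (((Real.sqrt s)⁻¹ : ℝ) : ℂ) :=
      Complex.conj_ofReal _
    rw [star_smul, smul_dotProduct, dotProduct_smul, smul_smul, hst, star_dotProduct_self_eq,
      smul_eq_mul, ← Complex.ofReal_mul, ← Complex.ofReal_mul, ← mul_inv, hss, ← hs,
      inv_mul_cancel₀ hpos.ne', Complex.ofReal_one]
  -- The columns `e p p₀ v` are orthonormal and as many as the dimension, and `e p q` permutes them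
  -- as `E_pq` permutes the standard basis.
  set U : Matrix k k ℂ := Matrix.of fun i p => (e p p₀ *ᵥ v) i with hU
  have hcol : ∀ (M : Matrix k k ℂ) a r, (M * U) a r = (M *ᵥ (e r p₀ *ᵥ v)) a := fun M a r => rfl
  have hUU : Uᴴ * U = 1 := by
    ext a b
    have : (Uᴴ * U) a b = star (e a p₀ *ᵥ v) ⬝ᵥ (e b p₀ *ᵥ v) := by
      simp only [Matrix.mul_apply, dotProduct, hU, Matrix.conjTranspose_apply, Matrix.of_apply,
        Pi.star_apply]
    rw [this, Matrix.star_mulVec, ← Matrix.dotProduct_mulVec, hstar, Matrix.mulVec_mulVec]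
    by_cases hab : a = b
    · subst hab; rw [hmul, hv, hvv, Matrix.one_apply_eq]
    · rw [hzero _ _ _ _ hab, Matrix.zero_mulVec, dotProduct_zero, Matrix.one_apply_ne hab]
  have hUm : U ∈ Matrix.unitaryGroup k ℂ := Matrix.mem_unitaryGroup_iff'.2 hUU
  refine ⟨U, hUm, fun p q => ?_⟩
  have h1 : e p q * U = U * Matrix.single p q 1 := by
    ext a r
    rw [hcol, Matrix.mulVec_mulVec]
    by_cases hqr : q = r
    · subst hqr
      rw [hmul, Matrix.mul_single_apply_same, mul_one]
      rfl
    · rw [hzero _ _ _ _ hqr, Matrix.zero_mulVec, Matrix.mul_single_apply_of_ne _ _ _ _ _ (Ne.symm hqr)]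
      rfl
  rw [← h1, mul_assoc, ← Matrix.star_eq_conjTranspose, Matrix.mem_unitaryGroup_iff.1 hUm, mul_one]

end MatrixUnits

/-! ### Reduction to Hermitian matrices. -/

section Hermitian

theorem conj_mul_conj {k : Type*} [Fintype k] [DecidableEq k] {Z : Matrix k k ℂ} (hZ : Zᴴ * Z = 1)
    (C D : Matrix k k ℂ) : Z * C * Zᴴ * (Z * D * Zᴴ) = Z * (C * D) * Zᴴ := by
  calc Z * C * Zᴴ * (Z * D * Zᴴ) = Z * C * (Zᴴ * Z) * D * Zᴴ := by simp only [mul_assoc]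
    _ = _ := by rw [hZ, mul_one]; simp only [mul_assoc]

variable {ι : Type*}

theorem linearMap_ext_isHermitian {V : Type*} [AddCommGroup V] [Module ℂ V]
    {f g : Matrix ι ι ℂ →ₗ[ℂ] V} (h : ∀ A : Matrix ι ι ℂ, A.IsHermitian → f A = g A) : f = g := by
  ext1 A
  rw [← realPart_add_I_smul_imaginaryPart A, map_add, map_add, map_smul, map_smul,
    h _ (realPart A).2, h _ (imaginaryPart A).2]

theorem map_conjTranspose_of_isHermitian {k : Type*} {ψ : Matrix ι ι ℂ →ₗ[ℂ] Matrix k k ℂ}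
    (h : ∀ A : Matrix ι ι ℂ, A.IsHermitian → (ψ A)ᴴ = ψ A) (A : Matrix ι ι ℂ) :
    ψ Aᴴ = (ψ A)ᴴ := by
  have h1 : Matrix.IsHermitian (realPart A : Matrix ι ι ℂ) := (realPart A).2
  have h2 : Matrix.IsHermitian (imaginaryPart A : Matrix ι ι ℂ) := (imaginaryPart A).2
  conv_lhs => rw [← realPart_add_I_smul_imaginaryPart A]
  conv_rhs => rw [← realPart_add_I_smul_imaginaryPart A]
  rw [Matrix.conjTranspose_add, Matrix.conjTranspose_smul, h1.eq, h2.eq, map_add, map_add,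
    map_smul, map_smul, Matrix.conjTranspose_add, Matrix.conjTranspose_smul, h _ h1, h _ h2]

variable [Fintype ι]

/-- Since transposition reverses products and is an involution, composing with it where needed gives
a multiplicative `ρ` in both cases. -/
theorem exists_multiplicative {R : Type*} [Ring R] [Algebra ℂ R] {ψ : Matrix ι ι ℂ →ₗ[ℂ] R}
    (h : (∀ A B, ψ (A * B) = ψ A * ψ B) ∨ ∀ A B, ψ (A * B) = ψ B * ψ A) :
    ∃ (f : Matrix ι ι ℂ → Matrix ι ι ℂ) (ρ : Matrix ι ι ℂ →ₗ[ℂ] R),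
      (f = id ∨ f = Matrix.transpose) ∧ (∀ A, ρ A = ψ (f A)) ∧ (∀ A, ψ A = ρ (f A)) ∧
      (∀ A, f Aᴴ = (f A)ᴴ) ∧ (∀ A B, ρ (A * B) = ρ A * ρ B) := by
  rcases h with h | h
  · exact ⟨id, ψ, Or.inl rfl, fun _ => rfl, fun _ => rfl, fun _ => rfl, h⟩
  · refine ⟨Matrix.transpose, ψ ∘ₗ (Matrix.transposeLinearEquiv ι ι ℂ ℂ).toLinearMap, Or.inr rfl,
      fun _ => rfl, fun A => ?_, fun _ => rfl, fun A B => ?_⟩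
    · simp
    · simp [h]

variable [DecidableEq ι]

theorem exists_unitary_conj_diagonal {A : Matrix ι ι ℂ} (hA : A.IsHermitian) :
    ∃ X ∈ Matrix.unitaryGroup ι ℂ, ∃ a : ι → ℂ, star a = a ∧ A = X * Matrix.diagonal a * Xᴴ := by
  refine ⟨hA.eigenvectorUnitary, hA.eigenvectorUnitary.2, _, ?_, hA.spectral_theorem⟩
  ext i
  simp

/-- Polarization at `A + B` gives the Jordan identity for Hermitian pairs. Both sides are bilinear
over `ℂ`, and Hermitian matrices span. -/
theorem isJordanHom_of_isHermitian {R : Type*} [Ring R] [Algebra ℂ R] {ψ : Matrix ι ι ℂ →ₗ[ℂ] R}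
    (h1 : ψ 1 = 1) (h : ∀ A : Matrix ι ι ℂ, A.IsHermitian → ψ (A * A) = ψ A * ψ A) :
    IsJordanHom ψ := by
  refine ⟨h1, fun A B => ?_⟩
  have key : (LinearMap.mul ℂ (Matrix ι ι ℂ) + (LinearMap.mul ℂ (Matrix ι ι ℂ)).flip).compr₂ ψ =
      (LinearMap.mul ℂ R + (LinearMap.mul ℂ R).flip).compl₁₂ ψ ψ := by
    refine linearMap_ext_isHermitian fun A hA => linearMap_ext_isHermitian fun B hB => ?_
    change ψ (A * B + B * A) = ψ A * ψ B + ψ B * ψ A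
    have h2 := h _ (hA.add hB)
    simp only [mul_add, add_mul, map_add, h A hA, h B hB] at h2 ⊢
    rw [← sub_eq_zero] at h2 ⊢
    rw [← h2]
    abel
  exact LinearMap.congr_fun₂ key A B

end Hermitian

/-! ### From diagonal data to the tensor form. -/

section Structure

variable {ι κ : Type*} [Fintype ι] [DecidableEq ι] [Fintype κ] [DecidableEq κ]

/-- Commuting self-adjoint representations of two matrix algebras on a space of dimension the
product of their sizes are unitarily similar to the tensor product of the identities. -/
theorem exists_unitary_mul_eq_conj_kronecker [Nonempty ι] [Nonempty κ]
    {ρ₁ : Matrix ι ι ℂ →ₗ[ℂ] Matrix (ι × κ) (ι × κ) ℂ}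
    {ρ₂ : Matrix κ κ ℂ →ₗ[ℂ] Matrix (ι × κ) (ι × κ) ℂ}
    (hm₁ : ∀ A B, ρ₁ (A * B) = ρ₁ A * ρ₁ B) (hm₂ : ∀ A B, ρ₂ (A * B) = ρ₂ A * ρ₂ B)
    (hs₁ : ∀ A, ρ₁ Aᴴ = (ρ₁ A)ᴴ) (hs₂ : ∀ A, ρ₂ Aᴴ = (ρ₂ A)ᴴ) (hone₁ : ρ₁ 1 = 1) (hone₂ : ρ₂ 1 = 1)
    (hcomm : ∀ A B, ρ₁ A * ρ₂ B = ρ₂ B * ρ₁ A) :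
    ∃ U ∈ Matrix.unitaryGroup (ι × κ) ℂ, ∀ A B, ρ₁ A * ρ₂ B = U * (A ⊗ₖ B) * Uᴴ := by
  set e : ι × κ → ι × κ → Matrix (ι × κ) (ι × κ) ℂ := fun p q =>
    ρ₁ (Matrix.single p.1 q.1 1) * ρ₂ (Matrix.single p.2 q.2 1) with he
  have hee : ∀ p q r s, e p q * e r s = ρ₁ (Matrix.single p.1 q.1 1 * Matrix.single r.1 s.1 1) *
      ρ₂ (Matrix.single p.2 q.2 1 * Matrix.single r.2 s.2 1) := by
    intro p q r s
    rw [hm₁, hm₂]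
    simp only [he]
    rw [mul_assoc, ← mul_assoc (ρ₂ _), ← hcomm]
    simp only [mul_assoc]
  have hsum : ∑ p, e p p = 1 := by
    rw [Fintype.sum_prod_type]
    simp only [he]
    simp_rw [← Finset.mul_sum, ← map_sum]
    rw [← Finset.sum_mul, ← map_sum, Matrix.sum_single_one, Matrix.sum_single_one, hone₁, hone₂,
      one_mul]
  obtain ⟨p₀, hp₀⟩ : ∃ p₀, e p₀ p₀ ≠ 0 := by
    by_contra! h
    simp [h] at hsum
  obtain ⟨U, hU, h⟩ := exists_unitary_of_matrixUnits (e := e)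
    (fun p q r => by
      rw [hee, Matrix.single_mul_single_same, Matrix.single_mul_single_same, one_mul])
    (fun p q r s hqr => by
      rw [hee]
      by_cases h1 : q.1 = r.1
      · have h2 : q.2 ≠ r.2 := fun h2 => hqr (Prod.ext h1 h2)
        rw [Matrix.single_mul_single_of_ne _ _ _ _ h2, map_zero, mul_zero]
      · rw [Matrix.single_mul_single_of_ne _ _ _ _ h1, map_zero, zero_mul])
    (fun p q => by
      simp only [he]
      rw [Matrix.conjTranspose_mul, ← hs₁, ← hs₂, Matrix.conjTranspose_single,
        Matrix.conjTranspose_single, star_one, hcomm]) hp₀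
  refine ⟨U, hU, fun A B => ?_⟩
  have key : (LinearMap.mul ℂ (Matrix (ι × κ) (ι × κ) ℂ)).compl₁₂ ρ₁ ρ₂ =
      (Matrix.kroneckerBilinear (R := ℂ)).compr₂ (LinearMap.mulLeftRight ℂ (U, Uᴴ)) := by
    refine Matrix.ext_linearMap ℂ fun i j => LinearMap.ext_ring
      (Matrix.ext_linearMap ℂ fun k l => LinearMap.ext_ring ?_)
    change ρ₁ (Matrix.single i j 1) * ρ₂ (Matrix.single k l 1) =
      U * (Matrix.single i j (1 : ℂ) ⊗ₖ Matrix.single k l (1 : ℂ)) * Uᴴ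
    rw [Matrix.single_kronecker_single, one_mul, ← h]
  exact LinearMap.congr_fun₂ key A B

/-- For Hermitian `A` and `B`, diagonalization places `A ⊗ B`, `A ⊗ 1`, `1 ⊗ B` and the squares of
the factors under the same `W`. Although `W` varies with `A` and `B`, the algebraic relations
between the images no longer mention it, so they extend by linearity to all matrices. -/
theorem exists_unitary_apply_kronecker [Nonempty ι] [Nonempty κ]
    {χ : Matrix (ι × κ) (ι × κ) ℂ →ₗ[ℂ] Matrix (ι × κ) (ι × κ) ℂ}
    (hχ : ∀ X ∈ Matrix.unitaryGroup ι ℂ, ∀ Y ∈ Matrix.unitaryGroup κ ℂ,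
      ∃ W ∈ Matrix.unitaryGroup (ι × κ) ℂ, ∀ (a : ι → ℂ) (b : κ → ℂ),
        χ ((X * Matrix.diagonal a * Xᴴ) ⊗ₖ (Y * Matrix.diagonal b * Yᴴ)) =
          W * (Matrix.diagonal a ⊗ₖ Matrix.diagonal b) * Wᴴ) :
    ∃ U ∈ Matrix.unitaryGroup (ι × κ) ℂ,
      ∃ (f : Matrix ι ι ℂ → Matrix ι ι ℂ) (g : Matrix κ κ ℂ → Matrix κ κ ℂ),
        (f = id ∨ f = Matrix.transpose) ∧ (g = id ∨ g = Matrix.transpose) ∧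
        ∀ A B, χ (A ⊗ₖ B) = U * (f A ⊗ₖ g B) * Uᴴ := by
  have hherm : ∀ (A : Matrix ι ι ℂ) (B : Matrix κ κ ℂ), A.IsHermitian → B.IsHermitian →
      (χ (A ⊗ₖ B))ᴴ = χ (A ⊗ₖ B) ∧ χ (A ⊗ₖ 1) * χ (1 ⊗ₖ B) = χ (A ⊗ₖ B) ∧
      χ (1 ⊗ₖ B) * χ (A ⊗ₖ 1) = χ (A ⊗ₖ B) ∧ χ ((A * A) ⊗ₖ 1) = χ (A ⊗ₖ 1) * χ (A ⊗ₖ 1) ∧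
      χ (1 ⊗ₖ (B * B)) = χ (1 ⊗ₖ B) * χ (1 ⊗ₖ B) ∧ χ (1 ⊗ₖ 1) = 1 := by
    intro A B hA hB
    obtain ⟨X, hX, a, ha, hAX⟩ := exists_unitary_conj_diagonal hA
    obtain ⟨Y, hY, b, hb, hBY⟩ := exists_unitary_conj_diagonal hB
    obtain ⟨W, hW, h⟩ := hχ X hX Y hY
    have hXX : Xᴴ * X = 1 := Matrix.mem_unitaryGroup_iff'.1 hX
    have hYY : Yᴴ * Y = 1 := Matrix.mem_unitaryGroup_iff'.1 hY
    have hWW : Wᴴ * W = 1 := Matrix.mem_unitaryGroup_iff'.1 hW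
    have hX1 : X * Matrix.diagonal (fun _ => 1) * Xᴴ = 1 := by
      rw [Matrix.diagonal_one, mul_one]; exact Matrix.mem_unitaryGroup_iff.1 hX
    have hY1 : Y * Matrix.diagonal (fun _ => 1) * Yᴴ = 1 := by
      rw [Matrix.diagonal_one, mul_one]; exact Matrix.mem_unitaryGroup_iff.1 hY
    have hA2 : A * A = X * Matrix.diagonal (fun i => a i * a i) * Xᴴ := by
      rw [hAX, conj_mul_conj hXX, Matrix.diagonal_mul_diagonal]
    have hB2 : B * B = Y * Matrix.diagonal (fun i => b i * b i) * Yᴴ := by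
      rw [hBY, conj_mul_conj hYY, Matrix.diagonal_mul_diagonal]
    have e0 : χ (A ⊗ₖ B) = W * (Matrix.diagonal a ⊗ₖ Matrix.diagonal b) * Wᴴ := by
      rw [hAX, hBY, h]
    have e1 : χ (A ⊗ₖ 1) = W * (Matrix.diagonal a ⊗ₖ 1) * Wᴴ := by
      have := h a fun _ => 1
      rwa [hY1, ← hAX, Matrix.diagonal_one] at this
    have e2 : χ (1 ⊗ₖ B) = W * (1 ⊗ₖ Matrix.diagonal b) * Wᴴ := by
      have := h (fun _ => 1) b
      rwa [hX1, ← hBY, Matrix.diagonal_one] at this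
    refine ⟨?_, ?_, ?_, ?_, ?_, ?_⟩
    · rw [e0, Matrix.conjTranspose_mul, Matrix.conjTranspose_mul, Matrix.conjTranspose_kronecker,
        Matrix.diagonal_conjTranspose, Matrix.diagonal_conjTranspose, ha, hb,
        Matrix.conjTranspose_conjTranspose, mul_assoc]
    · rw [e0, e1, e2, conj_mul_conj hWW, ← Matrix.mul_kronecker_mul, mul_one, one_mul]
    · rw [e0, e1, e2, conj_mul_conj hWW, ← Matrix.mul_kronecker_mul, mul_one, one_mul]
    · rw [hA2, e1, conj_mul_conj hWW, ← Matrix.mul_kronecker_mul, Matrix.diagonal_mul_diagonal, mul_one]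
      nth_rewrite 1 [← hY1]
      rw [h, Matrix.diagonal_one]
    · rw [hB2, e2, conj_mul_conj hWW, ← Matrix.mul_kronecker_mul, Matrix.diagonal_mul_diagonal, mul_one]
      nth_rewrite 1 [← hX1]
      rw [h, Matrix.diagonal_one]
    · nth_rewrite 1 [← hX1]
      rw [← hY1, h, Matrix.diagonal_one, Matrix.diagonal_one, Matrix.one_kronecker_one, mul_one]
      exact Matrix.mem_unitaryGroup_iff.1 hW
  set ψ₁ : Matrix ι ι ℂ →ₗ[ℂ] Matrix (ι × κ) (ι × κ) ℂ :=
    χ ∘ₗ (Matrix.kroneckerBilinear (R := ℂ)).flip 1 with hψ₁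
  set ψ₂ : Matrix κ κ ℂ →ₗ[ℂ] Matrix (ι × κ) (ι × κ) ℂ :=
    χ ∘ₗ (Matrix.kroneckerBilinear (R := ℂ)) 1 with hψ₂
  have h1 : Matrix.IsHermitian (1 : Matrix ι ι ℂ) := Matrix.isHermitian_one
  have h1' : Matrix.IsHermitian (1 : Matrix κ κ ℂ) := Matrix.isHermitian_one
  have hone := (hherm 1 1 h1 h1').2.2.2.2.2
  have hJ₁ : IsJordanHom ψ₁ := isJordanHom_of_isHermitian hone
    fun A hA => (hherm A 1 hA h1').2.2.2.1
  have hJ₂ : IsJordanHom ψ₂ := isJordanHom_of_isHermitian hone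
    fun B hB => (hherm 1 B h1 hB).2.2.2.2.1
  have hS₁ := map_conjTranspose_of_isHermitian (ψ := ψ₁) fun A hA => (hherm A 1 hA h1').1
  have hS₂ := map_conjTranspose_of_isHermitian (ψ := ψ₂) fun B hB => (hherm 1 B h1 hB).1
  have hprod : ∀ A B, ψ₁ A * ψ₂ B = χ (A ⊗ₖ B) := by
    have key : (LinearMap.mul ℂ (Matrix (ι × κ) (ι × κ) ℂ)).compl₁₂ ψ₁ ψ₂ =
        (Matrix.kroneckerBilinear (R := ℂ)).compr₂ χ :=
      linearMap_ext_isHermitian fun A hA => linearMap_ext_isHermitian fun B hB =>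
        (hherm A B hA hB).2.1
    exact LinearMap.congr_fun₂ key
  have hprod' : ∀ A B, ψ₂ B * ψ₁ A = χ (A ⊗ₖ B) := by
    have key : (LinearMap.mul ℂ (Matrix (ι × κ) (ι × κ) ℂ)).flip.compl₁₂ ψ₁ ψ₂ =
        (Matrix.kroneckerBilinear (R := ℂ)).compr₂ χ :=
      linearMap_ext_isHermitian fun A hA => linearMap_ext_isHermitian fun B hB =>
        (hherm A B hA hB).2.2.1
    exact LinearMap.congr_fun₂ key
  have hcomm : ∀ A B, ψ₁ A * ψ₂ B = ψ₂ B * ψ₁ A := fun A B => by rw [hprod, hprod']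
  obtain ⟨W, hW, hWχ⟩ := hχ 1 (one_mem _) 1 (one_mem _)
  have hq : ∀ i j, ψ₁ (Matrix.single i i 1) * ψ₂ (Matrix.single j j 1) =
      W * Matrix.single (i, j) (i, j) 1 * Wᴴ := by
    intro i j
    have := hWχ (Pi.single i 1) (Pi.single j 1)
    simp only [Matrix.diagonal_single, one_mul, mul_one, Matrix.conjTranspose_one] at this
    rw [hprod, this, Matrix.single_kronecker_single, one_mul]
  have hq0 : ∀ i j, ψ₁ (Matrix.single i i 1) * ψ₂ (Matrix.single j j 1) ≠ 0 := by
    intro i j h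
    have := trace_conj_single hW (i, j)
    rw [← hq, h, Matrix.trace_zero] at this
    exact zero_ne_one this
  -- A rank-one projection is a minimal idempotent of the full matrix algebra.
  have hmin : ∀ i j X, ∃ c : ℂ, (ψ₁ (Matrix.single i i 1) * ψ₂ (Matrix.single j j 1)) * X *
      (ψ₁ (Matrix.single i i 1) * ψ₂ (Matrix.single j j 1)) =
        c • (ψ₁ (Matrix.single i i 1) * ψ₂ (Matrix.single j j 1)) := by
    intro i j X
    refine ⟨(Wᴴ * X * W) (i, j) (i, j), ?_⟩
    rw [hq]
    calc W * Matrix.single (i, j) (i, j) 1 * Wᴴ * X * (W * Matrix.single (i, j) (i, j) 1 * Wᴴ)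
        = W * (Matrix.single (i, j) (i, j) 1 * (Wᴴ * X * W) * Matrix.single (i, j) (i, j) 1) * Wᴴ := by
          simp only [mul_assoc]
      _ = _ := by
          rw [Matrix.single_mul_mul_single, one_mul, mul_one, ← Matrix.smul_mul, ← Matrix.mul_smul,
            Matrix.smul_single, smul_eq_mul, mul_one]
  obtain ⟨f, ρ₁, hf, hρf, hψf, hfs, hm₁⟩ := exists_multiplicative
    (hJ₁.map_mul_or_map_mul_rev_of_commute hJ₂ hcomm hq0 hmin)
  obtain ⟨g, ρ₂, hg, hρg, hψg, hgs, hm₂⟩ := exists_multiplicative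
    (hJ₂.map_mul_or_map_mul_rev_of_commute hJ₁ (fun A B => (hcomm B A).symm)
      (fun j i => by rw [← hcomm]; exact hq0 i j) fun j i X => by rw [← hcomm]; exact hmin i j X)
  have hf1 : f 1 = 1 := by rcases hf with rfl | rfl <;> simp
  have hg1 : g 1 = 1 := by rcases hg with rfl | rfl <;> simp
  obtain ⟨U, hU, h⟩ := exists_unitary_mul_eq_conj_kronecker hm₁ hm₂
    (fun A => by rw [hρf, hρf, hfs, hS₁]) (fun A => by rw [hρg, hρg, hgs, hS₂])
    (by rw [hρf, hf1, hJ₁.map_one]) (by rw [hρg, hg1, hJ₂.map_one])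
    (fun A B => by rw [hρf, hρg, hcomm])
  exact ⟨U, hU, f, g, hf, hg, fun A B => by rw [← hprod, hψf, hψg, h]⟩

end Structure

/-! ### Partial transposition when one factor has size two. -/

section TwoByTwo

/-- Every complex two-by-two matrix is unitarily similar to its transpose. -/
theorem exists_unitary_transpose_eq_conj (B : Matrix (Fin 2) (Fin 2) ℂ) :
    ∃ V ∈ Matrix.unitaryGroup (Fin 2) ℂ, Bᵀ = V * B * Vᴴ := by
  -- For symmetric `V` of the shape below, `VB = BᵀV` is one complex linear equation in three real
  -- unknowns, so it has a nonzero real solution; normalizing it makes `V` unitary.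
  obtain ⟨c, hc, hc0⟩ : ∃ c : Fin 3 → ℝ, Fintype.linearCombination ℝ
      ![B 0 1 - B 1 0, Complex.I * (B 0 1 + B 1 0), Complex.I * (B 1 1 - B 0 0)] c = 0 ∧ c ≠ 0 :=
    Submodule.exists_mem_ne_zero_of_ne_bot (LinearMap.ker_ne_bot_of_finrank_lt (by simp))
  simp only [Fintype.linearCombination_apply, Fin.sum_univ_three, Matrix.cons_val,
    Complex.real_smul] at hc
  set s : ℝ := c 0 ^ 2 + c 1 ^ 2 + c 2 ^ 2 with hs
  have hpos : 0 < s := by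
    by_contra hle
    apply hc0
    ext i
    have h0 : c 0 ^ 2 + c 1 ^ 2 + c 2 ^ 2 ≤ 0 := not_lt.1 hle
    fin_cases i <;> simp <;> refine pow_eq_zero_iff two_ne_zero |>.1 ?_ <;>
      nlinarith [sq_nonneg (c 0), sq_nonneg (c 1), sq_nonneg (c 2)]
  have hss : ((Real.sqrt s)⁻¹ : ℝ) ^ 2 * s = 1 := by
    rw [inv_pow, Real.sq_sqrt hpos.le, inv_mul_cancel₀ hpos.ne']
  set r : ℝ := (Real.sqrt s)⁻¹
  have hrs : (r : ℂ) ^ 2 * ((c 0 : ℂ) ^ 2 + (c 1 : ℂ) ^ 2 + (c 2 : ℂ) ^ 2) = 1 := by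
    exact_mod_cast hss
  set V : Matrix (Fin 2) (Fin 2) ℂ := (r : ℂ) •
    !![(c 0 : ℂ) + Complex.I * c 1, Complex.I * c 2; Complex.I * c 2, (c 0 : ℂ) - Complex.I * c 1]
    with hV
  have hVV : V * Vᴴ = 1 := by
    have hI := Complex.I_sq
    ext i j
    fin_cases i <;> fin_cases j <;>
      simp [hV, Matrix.mul_apply, Fin.sum_univ_two]
    · linear_combination hrs - r ^ 2 * (c 1 ^ 2 + c 2 ^ 2) * hI
    · ring
    · ring
    · linear_combination hrs - r ^ 2 * (c 1 ^ 2 + c 2 ^ 2) * hI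
  have hVB : V * B = Bᵀ * V := by
    ext i j
    fin_cases i <;> fin_cases j <;>
      simp [hV, Matrix.mul_apply, Fin.sum_univ_two]
    · ring
    · linear_combination r * hc
    · linear_combination -r * hc
    · ring
  exact ⟨V, Matrix.mem_unitaryGroup_iff.2 hVV, by rw [hVB, mul_assoc, hVV, mul_one]⟩

variable {κ : Type*} [Fintype κ]

theorem numericalRadius_kronecker_transpose (A : Matrix κ κ ℂ) {ι : Type*} [Fintype ι]
    (B : Matrix ι ι ℂ) : numericalRadius (Aᵀ ⊗ₖ Bᵀ) = numericalRadius (A ⊗ₖ B) := by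
  rw [Matrix.kroneckerMap_transpose, numericalRadius_transpose]

theorem numericalRadius_transpose_kronecker_of_fin_two (A : Matrix (Fin 2) (Fin 2) ℂ)
    (B : Matrix κ κ ℂ) : numericalRadius (Aᵀ ⊗ₖ B) = numericalRadius (A ⊗ₖ B) := by
  classical
  obtain ⟨V, hV, h⟩ := exists_unitary_transpose_eq_conj A
  have : Aᵀ ⊗ₖ B = (V ⊗ₖ 1) * (A ⊗ₖ B) * (V ⊗ₖ (1 : Matrix κ κ ℂ))ᴴ := by
    rw [← conj_kronecker_conj, ← h, Matrix.conjTranspose_one, one_mul, mul_one]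
  rw [this, numericalRadius_conj (Matrix.kronecker_mem_unitary hV (one_mem _))]

theorem numericalRadius_kronecker_transpose_of_fin_two (B : Matrix κ κ ℂ)
    (A : Matrix (Fin 2) (Fin 2) ℂ) : numericalRadius (B ⊗ₖ Aᵀ) = numericalRadius (B ⊗ₖ A) := by
  classical
  obtain ⟨V, hV, h⟩ := exists_unitary_transpose_eq_conj A
  have : B ⊗ₖ Aᵀ = (1 ⊗ₖ V) * (B ⊗ₖ A) * ((1 : Matrix κ κ ℂ) ⊗ₖ V)ᴴ := by
    rw [← conj_kronecker_conj, ← h, Matrix.conjTranspose_one, one_mul, mul_one]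
  rw [this, numericalRadius_conj (Matrix.kronecker_mem_unitary (one_mem _) hV)]

/-- Transposing either factor alone has the same effect on the numerical radius, since the two
results are transposes of each other. So if one size is 2, the two-by-two case handles a
transposition of the other factor as well. -/
theorem numericalRadius_map_kronecker_map {m n : ℕ} (hm : 2 ≤ m) (hn : 2 ≤ n)
    {f : Matrix (Fin m) (Fin m) ℂ → Matrix (Fin m) (Fin m) ℂ}
    {g : Matrix (Fin n) (Fin n) ℂ → Matrix (Fin n) (Fin n) ℂ}
    (hf : f = id ∨ f = Matrix.transpose) (hg : g = id ∨ g = Matrix.transpose)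
    (hfg : 3 ≤ m → 3 ≤ n → (f = id ∧ g = id) ∨ (f = Matrix.transpose ∧ g = Matrix.transpose))
    (A : Matrix (Fin m) (Fin m) ℂ) (B : Matrix (Fin n) (Fin n) ℂ) :
    numericalRadius (f A ⊗ₖ g B) = numericalRadius (A ⊗ₖ B) := by
  by_cases h : 3 ≤ m ∧ 3 ≤ n
  · rcases hfg h.1 h.2 with ⟨rfl, rfl⟩ | ⟨rfl, rfl⟩
    · rfl
    · exact numericalRadius_kronecker_transpose A B
  have h2 : m = 2 ∨ n = 2 := by omega
  have key : numericalRadius (Aᵀ ⊗ₖ B) = numericalRadius (A ⊗ₖ B) ∧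
      numericalRadius (A ⊗ₖ Bᵀ) = numericalRadius (A ⊗ₖ B) := by
    have e : numericalRadius (Aᵀ ⊗ₖ B) = numericalRadius (A ⊗ₖ Bᵀ) := by
      rw [← numericalRadius_kronecker_transpose A Bᵀ, Matrix.transpose_transpose]
    rcases h2 with rfl | rfl
    · exact ⟨numericalRadius_transpose_kronecker_of_fin_two A B,
        e ▸ numericalRadius_transpose_kronecker_of_fin_two A B⟩
    · exact ⟨e ▸ numericalRadius_kronecker_transpose_of_fin_two A B,
        numericalRadius_kronecker_transpose_of_fin_two A B⟩
  rcases hf with rfl | rfl <;> rcases hg with rfl | rfl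
  · rfl
  · exact key.2
  · exact key.1
  · exact numericalRadius_kronecker_transpose A B

end TwoByTwo

/-! ### A pair of weighted shifts that excludes mixed types in sizes at least three. -/

section MixedTypes

theorem dotProduct_single_mulVec {k : Type*} [Fintype k] [DecidableEq k] (p q : k) (c : ℂ)
    (u : k → ℂ) : star u ⬝ᵥ (Matrix.single p q c *ᵥ u) = star (u p) * (c * u q) := by
  rw [Matrix.single_mulVec]
  simp [dotProduct, Function.update_apply]

variable {ι κ : Type*} [Fintype ι] [DecidableEq ι] [Fintype κ] [DecidableEq κ]

/-- A weighted shift, as a matrix of size at least three. -/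
def weightedShift (i : Fin 3 ↪ ι) : Matrix ι ι ℂ :=
  Matrix.single (i 0) (i 1) 1 + Matrix.single (i 1) (i 2) 2

/-- In the tensor square the weights `1` and `4` lie on one chain `(0,0), (1,1), (2,2)`, of
numerical radius `√17 / 2 > 2`. The vector `(1, 4, 4)` approximates the maximizer `(1, √17, 4)` and
gives `68 / 33`. -/
theorem two_lt_numericalRadius_weightedShift (i : Fin 3 ↪ ι) (j : Fin 3 ↪ κ) :
    2 < numericalRadius (weightedShift i ⊗ₖ weightedShift j) := by
  set u : ι × κ → ℂ := Pi.single (i 0, j 0) 1 + Pi.single (i 1, j 1) 4 + Pi.single (i 2, j 2) 4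
    with hu
  have hsum : ∑ p, ‖u p‖ ^ 2 = 33 := by
    have hp : ∀ p, ‖u p‖ ^ 2 = (if p = (i 0, j 0) then 1 else 0) +
        (if p = (i 1, j 1) then 16 else 0) + (if p = (i 2, j 2) then (16 : ℝ) else 0) := by
      intro p
      by_cases h0 : p = (i 0, j 0)
      · subst h0; simp [hu]
      by_cases h1 : p = (i 1, j 1)
      · subst h1; simp [hu]; norm_num
      by_cases h2 : p = (i 2, j 2)
      · subst h2; simp [hu]; norm_num
      simp [hu, h0, h1, h2]
    simp_rw [hp, Finset.sum_add_distrib, Finset.sum_ite_eq', Finset.mem_univ, if_true]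
    norm_num
  have h := norm_le_numericalRadius_mul (weightedShift i ⊗ₖ weightedShift j) u
  have hval : star u ⬝ᵥ ((weightedShift i ⊗ₖ weightedShift j) *ᵥ u) = 68 := by
    simp only [weightedShift, Matrix.add_kronecker, Matrix.kronecker_add,
      Matrix.single_kronecker_single, Matrix.add_mulVec, dotProduct_add, dotProduct_single_mulVec]
    simp [hu]
    norm_num
  rw [hval, hsum] at h
  norm_num at h
  linarith

/-- Transposing one factor breaks up the chain: the weight `4` becomes isolated and contributes `2`,
the two weights `2` form a chain contributing `√2`, and the isolated weight `1` contributes `1 / 2`.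
These act on disjoint sets of coordinates. -/
theorem numericalRadius_weightedShift_transpose_le (i : Fin 3 ↪ ι) (j : Fin 3 ↪ κ) :
    numericalRadius (weightedShift i ⊗ₖ (weightedShift j)ᵀ) ≤ 2 := by
  have : Nonempty ι := ⟨i 0⟩
  have : Nonempty κ := ⟨j 0⟩
  refine numericalRadius_le fun u => ?_
  have hsum : ∑ p : Fin 3 × Fin 3, ‖u ((i.prodMap j) p)‖ ^ 2 ≤ ∑ p, ‖u p‖ ^ 2 := by
    rw [← Finset.sum_map Finset.univ (i.prodMap j) fun p => ‖u p‖ ^ 2]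
    exact Finset.sum_le_univ_sum_of_nonneg fun _ => by positivity
  simp only [Fintype.sum_prod_type, Fin.sum_univ_three, Function.Embedding.coe_prodMap,
    Prod.map_apply] at hsum
  simp only [weightedShift, Matrix.transpose_add, Matrix.transpose_single, Matrix.add_kronecker,
    Matrix.kronecker_add, Matrix.single_kronecker_single, Matrix.add_mulVec, dotProduct_add,
    dotProduct_single_mulVec]
  have h1 : ‖star (u (i 0, j 1)) * (1 * 1 * u (i 1, j 0))‖ =
      ‖u (i 0, j 1)‖ * ‖u (i 1, j 0)‖ := by simp
  have h2 : ‖star (u (i 0, j 2)) * (1 * 2 * u (i 1, j 1))‖ =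
      2 * (‖u (i 0, j 2)‖ * ‖u (i 1, j 1)‖) := by simp; ring
  have h3 : ‖star (u (i 1, j 1)) * (2 * 1 * u (i 2, j 0))‖ =
      2 * (‖u (i 1, j 1)‖ * ‖u (i 2, j 0)‖) := by simp; ring
  have h4 : ‖star (u (i 1, j 2)) * (2 * 2 * u (i 2, j 1))‖ =
      4 * (‖u (i 1, j 2)‖ * ‖u (i 2, j 1)‖) := by simp; ring
  have hn : ∀ a b c d : ℂ, ‖a + b + (c + d)‖ ≤ ‖a‖ + ‖b‖ + (‖c‖ + ‖d‖) := fun a b c d =>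
    (norm_add_le _ _).trans (add_le_add (norm_add_le _ _) (norm_add_le _ _))
  have hle : ‖star (u (i 0, j 1)) * (1 * 1 * u (i 1, j 0)) +
      star (u (i 0, j 2)) * (1 * 2 * u (i 1, j 1)) +
      (star (u (i 1, j 1)) * (2 * 1 * u (i 2, j 0)) +
      star (u (i 1, j 2)) * (2 * 2 * u (i 2, j 1)))‖ ≤ 2 * ∑ p, ‖u p‖ ^ 2 := by
    refine (hn _ _ _ _).trans ?_
    rw [h1, h2, h3, h4, Fintype.sum_prod_type]
    have k1 := two_mul_le_add_sq ‖u (i 0, j 1)‖ ‖u (i 1, j 0)‖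
    -- The two entries of weight `2` share the coordinate `(1, 1)`, so each product is bounded using
    -- only part of the square available there.
    have k2 := sq_nonneg (2 * ‖u (i 0, j 2)‖ - ‖u (i 1, j 1)‖)
    have k3 := sq_nonneg (2 * ‖u (i 2, j 0)‖ - ‖u (i 1, j 1)‖)
    have k4 := sq_nonneg (‖u (i 1, j 2)‖ - ‖u (i 2, j 1)‖)
    nlinarith [sq_nonneg ‖u (i 0, j 0)‖, sq_nonneg ‖u (i 2, j 2)‖, sq_nonneg ‖u (i 0, j 1)‖,
      sq_nonneg ‖u (i 1, j 0)‖, sq_nonneg ‖u (i 1, j 1)‖]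
  convert hle using 2
  ring

end MixedTypes

/-! ### The equivalence. -/

theorem theorem2p3 (m n : ℕ) (hm : 2 ≤ m) (hn : 2 ≤ n)
    (φ : Matrix (Fin m × Fin n) (Fin m × Fin n) ℂ →ₗ[ℂ]
      Matrix (Fin m × Fin n) (Fin m × Fin n) ℂ) :
    (∀ (A : Matrix (Fin m) (Fin m) ℂ) (B : Matrix (Fin n) (Fin n) ℂ),
      numericalRadius (φ (A ⊗ₖ B)) = numericalRadius (A ⊗ₖ B)) ↔
    ∃ U ∈ Matrix.unitaryGroup (Fin m × Fin n) ℂ, ∃ ξ : ℂ, ‖ξ‖ = 1 ∧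
      ∃ (φ₁ : Matrix (Fin m) (Fin m) ℂ → Matrix (Fin m) (Fin m) ℂ)
        (φ₂ : Matrix (Fin n) (Fin n) ℂ → Matrix (Fin n) (Fin n) ℂ),
        (φ₁ = id ∨ φ₁ = Matrix.transpose) ∧
        (φ₂ = id ∨ φ₂ = Matrix.transpose) ∧
        (3 ≤ m → 3 ≤ n →
          (φ₁ = id ∧ φ₂ = id) ∨ (φ₁ = Matrix.transpose ∧ φ₂ = Matrix.transpose)) ∧
        ∀ (A : Matrix (Fin m) (Fin m) ℂ) (B : Matrix (Fin n) (Fin n) ℂ),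
          φ (A ⊗ₖ B) = ξ • (U * (φ₁ A ⊗ₖ φ₂ B) * Uᴴ) := by
  constructor
  · intro hφ
    have : Nonempty (Fin m) := ⟨⟨0, by omega⟩⟩
    have : Nonempty (Fin n) := ⟨⟨0, by omega⟩⟩
    obtain ⟨ξ, hξ, h⟩ := exists_unitary_apply_conj_diagonal hφ
    have hξ0 : ξ ≠ 0 := by
      rintro rfl; simp at hξ
    obtain ⟨U, hU, f, g, hf, hg, hfg⟩ := exists_unitary_apply_kronecker (χ := ξ⁻¹ • φ)
      fun X hX Y hY => by
        obtain ⟨W, hW, hWφ⟩ := h X hX Y hY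
        exact ⟨W, hW, fun a b => by
          rw [LinearMap.smul_apply, hWφ, smul_smul, inv_mul_cancel₀ hξ0, one_smul]⟩
    have hfg' : ∀ A B, φ (A ⊗ₖ B) = ξ • (U * (f A ⊗ₖ g B) * Uᴴ) := by
      intro A B
      rw [← hfg, LinearMap.smul_apply, smul_smul, mul_inv_cancel₀ hξ0, one_smul]
    refine ⟨U, hU, ξ, hξ, f, g, hf, hg, fun hm3 hn3 => ?_, hfg'⟩
    have hlt := two_lt_numericalRadius_weightedShift (Fin.castLEEmb hm3) (Fin.castLEEmb hn3)
    have hle := numericalRadius_weightedShift_transpose_le (Fin.castLEEmb hm3) (Fin.castLEEmb hn3)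
    have heq := hφ (weightedShift (Fin.castLEEmb hm3)) (weightedShift (Fin.castLEEmb hn3))
    rw [hfg', numericalRadius_smul hξ, numericalRadius_conj hU] at heq
    rcases hf with rfl | rfl <;> rcases hg with rfl | rfl
    · exact Or.inl ⟨rfl, rfl⟩
    · rw [id] at heq
      linarith
    -- A full transposition moves the transpose from the first factor to the second, the case
    -- already estimated.
    · rw [id, ← numericalRadius_kronecker_transpose, Matrix.transpose_transpose] at heq
      linarith
    · exact Or.inr ⟨rfl, rfl⟩
  · rintro ⟨U, hU, ξ, hξ, f, g, hf, hg, hfg, h⟩ A B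
    rw [h, numericalRadius_smul hξ, numericalRadius_conj hU,
      numericalRadius_map_kronecker_map hm hn hf hg hfg]
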